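/- Let $\mathbb X$ and $\mathbb Y$ be finite-dimensional real inner product spaces, and let $e_1,\dots,e_m$ be an orthonormal basis of $\mathbb Y$ (the canonical one in case $\mathbb Y=\mathbb R^m$). Let $g\colon\mathbb X\to\mathbb Y$ be twice continuously differentiable, let $D\subset\mathbb Y$ be closed, and let $\Phi\colon\mathbb X\rightrightarrows\mathbb Y$ be the constraint mapping $\Phi(x):=g(x)-D$. Let $\bar x\in\mathbb X$ satisfy $0\in\Phi(\bar x)$, i.e. $g(\bar x)\in D$, and let $u\in\mathbb X$ with $\|u\|=1$. **Notation.** $\nabla g(\bar x)$ is the derivative of $g$ at $\bar x$ and $\nabla g(\bar x)^*$ its adjoint. For $y^*\in\mathbb Y$, $\nabla^2\langle y^*,g\rangle(\bar x)(u)\in\mathbb X$ is the Hessian at $\bar x$ of $x\mapsto\langle y^*,g(x)\rangle$ applied to $u$, and $\nabla^2g(\bar x)[u,u]:=\sum_{i=1}^m\langle u,\nabla^2\langle e_i,g\rangle(\bar x)(u)\rangle e_i$. Below, $t_k\searrow0$ means $t_k>0$ for all $k\in\mathbb N$ and $t_k\to0$. For a set $Q$ in a Euclidean space and $x\in Q$,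 let - $\mathcal T_Q(x)$ be the set of all $d$ for which there are $d_k\to d$, $t_k\searrow0$ with $x+t_kd_k\in Q$ for all $k$; - $\widehat{\mathcal N}_Q(x)$ be the set of all $\eta$ with $\langle\eta,x'-x\rangle\le o(\|x'-x\|)$ for $x'\in Q$, $x'\to x$; - $\mathcal N_Q(x)$ be the set of all $\eta$ for which there are $x_k\to x$ in $Q$ and $\eta_k\to\eta$ with $\eta_k\in\widehat{\mathcal N}_Q(x_k)$ for all $k$; - $\mathcal N_Q(x;d)$ be the set of all $\eta$ for which there are $d_k\to d$, $t_k\searrow0$, $\eta_k\to\eta$ with $\eta_k\in\widehat{\mathcal N}_Q(x+t_kd_k)$ for all $k$. All these sets are empty if $x\notin Q$. For $\bar y^*\in\mathcal N_D(\bar y)$ and $w\in\mathbb Y$, the graphical derivative of the set-valued mapping $\mathcal N_D\colon\mathbb Y\rightrightarrows\mathbb Y$ is $D\mathcal N_D(\bar y,\bar y^*)(w):=\{v\mid(w,v)\in\mathcal T_{\operatorname{gph}\mathcal N_D}(\bar y,\bar y^*)\}$. For $\|w\|=1$, its graphical subderivative $D_{\rm sub}\mathcal N_D(\bar y,\bar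 y^*)(w)$ is the set of all $v$ with $\|v\|=1$ for which there are $w_k\to w$, $v_k\to v$, $t_k\searrow0$, $\tau_k\searrow0$ with $\tau_k/t_k\to\infty$ and $\bar y^*+\tau_kv_k\in\mathcal N_D(\bar y+t_kw_k)$ for all $k$. Both are empty if $\bar y^*\notin\mathcal N_D(\bar y)$. The set $D$ is locally polyhedral around $\bar y\in D$ if, for some $\varepsilon>0$, the set $D\cap\{z\mid|\langle e_i,z-\bar y\rangle|\le\varepsilon,\ i=1,\dots,m\}$ is a union of finitely many convex polyhedral sets (solution sets of finitely many affine inequalities). Finally, let $\mathbf T(u):=\mathcal T_{\mathcal T_D(g(\bar x))}(\nabla g(\bar x)u)$ and, for $s\in\mathbb X$, $w_s(u,0):=\nabla g(\bar x)s+\tfrac12\nabla^2g(\bar x)[u,u]$. **Claim.** Suppose that one of the following four conditions holds. (i) For all $y^*,z^*\in\mathbb Y$: if $\nabla g(\bar x)^*y^*=0$, $\nabla^2\langle y^*,g\rangle(\bar x)(u)+\nabla g(\bar x)^*z^*=0$, $y^*\in\mathcal N_D(g(\bar x);\nabla g(\bar x)u)$ and $\langle z^*,y^*\rangle=0$, then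 $y^*=0$. (ii) For all $y^*,z^*\in\mathbb Y$: if $\nabla g(\bar x)^*y^*=0$, $\nabla^2\langle y^*,g\rangle(\bar x)(u)+\nabla g(\bar x)^*z^*=0$, $y^*\in\mathcal N_D(g(\bar x);\nabla g(\bar x)u)$ and $z^*\in D\mathcal N_D(g(\bar x),y^*)(\nabla g(\bar x)u)$, then $y^*=0$. Furthermore, at least one of the following holds: (a) for all $y^*,\hat z^*\in\mathbb Y$: if $\nabla g(\bar x)^*y^*=0$, $\nabla g(\bar x)^*\hat z^*=0$, $y^*\in\mathcal N_D(g(\bar x);\nabla g(\bar x)u)$ and $\hat z^*\in D\mathcal N_D(g(\bar x),y^*)(0)$, then $\hat z^*=0$; (b) $\nabla g(\bar x)u\ne0$, and for all $y^*,\hat z^*\in\mathbb Y$: if $\nabla g(\bar x)^*y^*=0$, $\nabla g(\bar x)^*\hat z^*=0$ and $y^*\in\mathcal N_D(g(\bar x);\nabla g(\bar x)u)$, then $\hat z^*\notin D_{\rm sub}\mathcal N_D(g(\bar x),y^*)\bigl(\nabla g(\bar x)u/\|\nabla g(\bar x)u\|\bigr)$. (iii) $D$ is locally polyhedral around $g(\bar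 x)$, and for all $y^*,z^*\in\mathbb Y$: if $\nabla g(\bar x)^*y^*=0$, $\nabla^2\langle y^*,g\rangle(\bar x)(u)+\nabla g(\bar x)^*z^*=0$, $y^*\in\mathcal N_{\mathcal T_D(g(\bar x))}(\nabla g(\bar x)u)$ and $z^*\in\mathcal T_{\mathcal N_{\mathcal T_D(g(\bar x))}(\nabla g(\bar x)u)}(y^*)$, then $y^*=0$. (iv) $D$ is locally polyhedral around $g(\bar x)$, and for all $s\in\mathbb X$ and $y^*,z^*\in\mathbb Y$: if $\nabla g(\bar x)^*y^*=0$, $\nabla^2\langle y^*,g\rangle(\bar x)(u)+\nabla g(\bar x)^*z^*=0$, $y^*\in\mathcal N_{\mathbf T(u)}(w_s(u,0))$ and $z^*\in\mathcal T_{\mathcal N_{\mathbf T(u)}(w_s(u,0))}(y^*)$, then $y^*=0$. Then $\Phi$ is metrically pseudo-subregular of order $2$ in direction $u$ at $(\bar x,0)$: there are $\varepsilon,\delta,\kappa>0$ such that $$\|x-\bar x\|\,\operatorname{dist}(x,\Phi^{-1}(0))\le\kappa\,\operatorname{dist}(0,\Phi(x))$$ for all $x=\bar x+v$ with $\|v\|\le\varepsilon$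 and $\bigl\|\,\|v\|u-\|u\|v\,\bigr\|\le\delta\|u\|\|v\|$, where $\Phi^{-1}(0)=\{x\mid 0\in\Phi(x)\}$. -/

import Mathlib

open Filter Topology

noncomputable section

namespace PseudoSubreg

/-! ### Tangent and normal cones

All cones are empty at points outside of the set. In the text, `t ↘ 0` for a sequence of reals
means that `t k > 0` for all `k` and `t k → 0`. -/

/-- The (Bouligand) tangent cone `T_Q(x)`. -/
def tangentCone {E : Type*} [AddCommGroup E] [Module ℝ E] [TopologicalSpace E]
    (Q : Set E) (x : E) : Set E :=
  {d | x ∈ Q ∧ ∃ (dk : ℕ → E) (t : ℕ → ℝ),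
    Tendsto dk atTop (𝓝 d) ∧ (∀ k, 0 < t k) ∧ Tendsto t atTop (𝓝 0) ∧
    ∀ k, x + t k • dk k ∈ Q}

section Normals

variable {E : Type*} [NormedAddCommGroup E] [InnerProductSpace ℝ E]

/-- The regular (Fréchet) normal cone: all `η` with `⟪η, x' - x⟫ ≤ o(‖x' - x‖)` for `x' ∈ Q`. -/
def regularNormalCone (Q : Set E) (x : E) : Set E :=
  {η | x ∈ Q ∧ ∀ ε > 0, ∀ᶠ x' in 𝓝[Q] x, inner ℝ η (x' - x) ≤ ε * ‖x' - x‖}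

/-- The limiting (Mordukhovich) normal cone `N_Q(x)`. -/
def limitingNormalCone (Q : Set E) (x : E) : Set E :=
  {η | x ∈ Q ∧ ∃ (xk ηk : ℕ → E),
    (∀ k, xk k ∈ Q) ∧ Tendsto xk atTop (𝓝 x) ∧ Tendsto ηk atTop (𝓝 η) ∧
    ∀ k, ηk k ∈ regularNormalCone Q (xk k)}

/-- The directional limiting normal cone `N_Q(x; d)`. -/
def dirNormalCone (Q : Set E) (x d : E) : Set E :=
  {η | x ∈ Q ∧ ∃ (dk : ℕ → E) (t : ℕ → ℝ) (ηk : ℕ → E),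
    Tendsto dk atTop (𝓝 d) ∧ (∀ k, 0 < t k) ∧ Tendsto t atTop (𝓝 0) ∧
    Tendsto ηk atTop (𝓝 η) ∧ ∀ k, ηk k ∈ regularNormalCone Q (x + t k • dk k)}

end Normals

/-! ### Polyhedral sets -/

section Polyhedral

variable {Y : Type*} [NormedAddCommGroup Y] [InnerProductSpace ℝ Y]

/-- A convex polyhedral set: the solution set of finitely many affine inequalities. -/
def IsConvexPolyhedral (Q : Set Y) : Prop :=
  ∃ (n : ℕ) (a : Fin n → Y) (c : Fin n → ℝ), Q = {z | ∀ i, inner ℝ (a i) z ≤ c i}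

/-- A polyhedral set: a finite union of convex polyhedral sets. -/
def IsPolyhedral (Q : Set Y) : Prop :=
  ∃ (n : ℕ) (P : Fin n → Set Y), (∀ i, IsConvexPolyhedral (P i)) ∧ Q = ⋃ i, P i

/-- `Q` is locally polyhedral around `x`: the intersection of `Q` with some cube around `x` is
polyhedral. Coordinates are taken with respect to the orthonormal basis `e`
(for `ℝ^m`, this is the canonical one). -/
def IsLocallyPolyhedral {m : ℕ} (e : OrthonormalBasis (Fin m) ℝ Y) (Q : Set Y) (x : Y) : Prop :=
  ∃ ε > 0, IsPolyhedral (Q ∩ {z | ∀ i, |e.repr z i - e.repr x i| ≤ ε})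

end Polyhedral

/-! ### Set-valued mappings -/

section SetValued

/-- The graph of a set-valued mapping. -/
def gph {X Y : Type*} (Φ : X → Set Y) : Set (X × Y) := {p | p.2 ∈ Φ p.1}

variable {X Y : Type*} [NormedAddCommGroup X] [InnerProductSpace ℝ X]
  [NormedAddCommGroup Y] [InnerProductSpace ℝ Y]

/-- The graphical derivative: `gph DΦ(x̄, ȳ) = T_{gph Φ}(x̄, ȳ)`. -/
def graphicalDeriv (Φ : X → Set Y) (x : X) (y : Y) (u : X) : Set Y :=
  {v | (u, v) ∈ tangentCone (gph Φ) (x, y)}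

/-- The graphical subderivative, a set-valued mapping between the unit spheres
(with empty values away from the unit sphere of `X`). -/
def graphicalSubderiv (Φ : X → Set Y) (x : X) (y : Y) (u : X) : Set Y :=
  {v | (x, y) ∈ gph Φ ∧ ‖u‖ = 1 ∧ ‖v‖ = 1 ∧
    ∃ (uk : ℕ → X) (vk : ℕ → Y) (t τ : ℕ → ℝ),
      Tendsto uk atTop (𝓝 u) ∧ Tendsto vk atTop (𝓝 v) ∧
      (∀ k, 0 < t k) ∧ Tendsto t atTop (𝓝 0) ∧
      (∀ k, 0 < τ k) ∧ Tendsto τ atTop (𝓝 0) ∧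
      Tendsto (fun k => τ k / t k) atTop atTop ∧
      ∀ k, (x + t k • uk k, y + τ k • vk k) ∈ gph Φ}

/-- The directional neighborhood `𝔹_{ε,δ}(u)` of `u`. -/
def dirNhd (ε δ : ℝ) (u : X) : Set X :=
  {v | ‖‖v‖ • u - ‖u‖ • v‖ ≤ δ * ‖u‖ * ‖v‖ ∧ ‖v‖ ≤ ε}

/-- Metric pseudo-subregularity of order `γ` of `Φ` at `(x̄, ȳ)` in direction `u`. The distances
are extended-valued, so that the distance to the empty set is `∞`. -/
def IsMetricallyPseudoSubregular (γ : ℝ) (Φ : X → Set Y) (xb : X) (yb : Y) (u : X) : Prop :=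
  ∃ ε > 0, ∃ δ > 0, ∃ κ > 0, ∀ v ∈ dirNhd ε δ u,
    ENNReal.ofReal (‖(xb + v) - xb‖ ^ (γ - 1)) * Metric.infEDist (xb + v) {x | yb ∈ Φ x} ≤
      ENNReal.ofReal κ * Metric.infEDist yb (Φ (xb + v))

/-- The constraint mapping `Φ(x) = g(x) - D`. -/
def constraintMap (g : X → Y) (D : Set Y) (x : X) : Set Y := {y | ∃ d ∈ D, y = g x - d}

variable [FiniteDimensional ℝ X]

/-- `∇²⟨y*, g⟩(x)(u)`: the Hessian of the scalarization `⟨y*, g⟩` at `x`, applied to `u`, as an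
element of `X`. -/
def hessScalar (g : X → Y) (ystar : Y) (x u : X) : X :=
  fderiv ℝ (gradient (fun x' => inner ℝ ystar (g x'))) x u

/-- `∇²g(x)[u,u] = ∑ i, ⟨u, ∇²⟨e i, g⟩(x)(u)⟩ e i`. -/
def secondDeriv {m : ℕ} (e : OrthonormalBasis (Fin m) ℝ Y) (g : X → Y) (x u : X) : Y :=
  ∑ i, (inner ℝ u (hessScalar g (e i) x u) : ℝ) • e i

/-- `w_s(u, v) = ∇g(x) s + 1/2 ∇²g(x)[u,u] - v`. -/
def wVec {m : ℕ} (e : OrthonormalBasis (Fin m) ℝ Y) (g : X → Y) (x s u : X) (v : Y) : Y :=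
  fderiv ℝ g x s + (1 / 2 : ℝ) • secondDeriv e g x u - v

/-- `𝐓(u) = T_{T_D(g(x))}(∇g(x) u)`. -/
def bigT (g : X → Y) (D : Set Y) (x u : X) : Set Y :=
  tangentCone (tangentCone D (g x)) (fderiv ℝ g x u)

variable [FiniteDimensional ℝ Y]

/-- `∇g(x)* y*`, where `∇g(x)*` is the adjoint of the derivative of `g` at `x`. -/
def adjDeriv (g : X → Y) (x : X) (ystar : Y) : X :=
  ContinuousLinearMap.adjoint (fderiv ℝ g x) ystar

end SetValued

end PseudoSubreg

end

/-! Argue by contradiction. If the estimate fails, there are infeasible points `xb + v` with `v →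
0`, `v/‖v‖ → u`, at which `dist(g(xb + v), D)` is negligible against `‖v‖` times the distance `d` to
the feasible set. Near such a point, minimize `dist(g x, D)` plus a small multiple of the distance
to the point. The minimizer moves by much less than `d`, so it stays infeasible, and projecting its
`g`-value onto `D` gives `y_k ∈ D` and a unit regular normal `η_k`. With `t_k = ‖v‖` and `x_k` the
minimizer, `g x_k - y_k = o(t_k²)` and `∇g(x_k)* η_k = o(t_k)` (`exists_asymptotic_sequences`).

Pass to a limit `η`, of norm one. Expanding to second order at `xb` gives `∇g(xb)* η = 0`, shows
that `η` is a normal in direction `∇g(xb)u`, and yields `∇g(xb)* z_k → -∇²⟨η,g⟩(xb)(u)` for `z_k =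
(η_k - η)/t_k` (`exists_directional_multiplier`). It remains to replace the possibly unbounded `z_k`
by one vector `z` that satisfies the second-order equation and the extra restriction in the assumed
condition; then `η = 0`, which is absurd.

For (i), the range of a linear map is closed, and subtracting a multiple of `η` makes `z` orthogonal
to it. For (ii), bounded quotients have a cluster point in the graphical derivative, while unbounded
ones, normalized, violate (a) or (b) (`graphicalDeriv_alternative`). For (iii) and (iv), `D` is
locally a union of cells of a hyperplane arrangement, so along a subsequence the `η_k` lie in a
single polyhedral cone; linear images of polyhedral cones are closed, which supplies `z` without any
bound on `z_k` (`exists_multiplier_tangent_of_polyhedral`). -/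

namespace PseudoSubreg

/-! ### Polyhedral cones: finite generation and closed linear images. -/

section PolyhedralCones

variable {E : Type*} [NormedAddCommGroup E] [InnerProductSpace ℝ E]

/-- The polar cone of a set. -/
def polarCone (s : Set E) : Set E := {z | ∀ a ∈ s, inner ℝ a z ≤ (0 : ℝ)}

lemma isClosed_polarCone (s : Set E) : IsClosed (polarCone s) := by
  have : polarCone s = ⋂ a ∈ s, {z | inner ℝ a z ≤ (0 : ℝ)} := by
    ext z; simp [polarCone]
  rw [this]
  exact isClosed_biInter fun a _ => isClosed_le (by fun_prop) continuous_const

/-- A polyhedral cone has finitely many generators, in the sense that its polar cone is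
described by finitely many of its elements. -/
lemma exists_finite_generators [FiniteDimensional ℝ E] {s : Set E} (hs : s.Finite) :
    ∃ R ⊆ polarCone s, R.Finite ∧ polarCone R ⊆ polarCone (polarCone s) := by
  induction s, hs using Set.Finite.induction_on with
  | empty =>
    let b := stdOrthonormalBasis ℝ E
    refine ⟨Set.range b ∪ Set.range (fun i => -b i), by simp [polarCone],
      (Set.finite_range _).union (Set.finite_range _), ?_⟩
    intro η hη
    have : η = 0 := by
      apply b.repr.injective
      ext i
      have h1 := hη (b i) (Or.inl ⟨i, rfl⟩)
      have h2 := hη (-b i) (Or.inr ⟨i, rfl⟩)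
      rw [inner_neg_left] at h2
      rw [b.repr_apply_apply, map_zero, PiLp.zero_apply]
      linarith
    subst this
    intro z _
    simp
  | @insert a s _ _ ih =>
    obtain ⟨R, hRs, hRf, hR⟩ := ih
    -- Double description: on adding the inequality `a`, keep the generators that satisfy it, and
    -- combine each violating one with each strictly satisfying one into a vector on the hyperplane
    -- `a = 0`.
    let f : E × E → E := fun p => (inner ℝ a p.1 : ℝ) • p.2 - (inner ℝ a p.2 : ℝ) • p.1
    let R₁ : Set E := {r ∈ R | inner ℝ a r ≤ (0 : ℝ)}
    let R₂ : Set E := f '' ({r ∈ R | (0 : ℝ) < inner ℝ a r} ×ˢ {r ∈ R | inner ℝ a r < (0 : ℝ)})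
    refine ⟨R₁ ∪ R₂, ?_, (hRf.subset (Set.sep_subset _ _)).union
      (((hRf.subset (Set.sep_subset _ _)).prod (hRf.subset (Set.sep_subset _ _))).image _), ?_⟩
    · rintro z (⟨hz, hz0⟩ | ⟨⟨p, q⟩, ⟨⟨hp, hp0⟩, hq, hq0⟩, rfl⟩) b hb
      · rcases hb with rfl | hb
        · exact hz0
        · exact hRs hz b hb
      · simp only [f, inner_sub_right, inner_smul_right]
        rcases hb with rfl | hb
        · linarith
        · have h1 := hRs hp b hb
          have h2 := hRs hq b hb
          simp only at hp0 hq0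
          nlinarith
    · intro η hη
      -- Fourier–Motzkin for the multiplier `l`: generators with `⟨a, r⟩ > 0` bound it from below,
      -- those with `⟨a, r⟩ < 0` from above. `R₂` makes these bounds compatible, `R₁` makes the
      -- upper ones nonnegative.
      have key : ∃ l : ℝ, 0 ≤ l ∧ ∀ r ∈ R, inner ℝ r (η - l • a) ≤ (0 : ℝ) := by
        have hneg : ∀ r ∈ R, inner ℝ a r < (0 : ℝ) →
            ∀ p ∈ R, (0 : ℝ) < inner ℝ a p →
              (inner ℝ p η : ℝ) / inner ℝ a p ≤ inner ℝ r η / inner ℝ a r := by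
          intro r hr hr0 p hp hp0
          have := hη (f (p, r)) (Or.inr ⟨(p, r), ⟨⟨hp, hp0⟩, hr, hr0⟩, rfl⟩)
          simp only [f, inner_sub_left, real_inner_smul_left] at this
          rw [div_le_iff₀ hp0, div_mul_eq_mul_div, le_div_iff_of_neg hr0]
          nlinarith
        let P : Finset E := hRf.toFinset.filter (fun r => (0 : ℝ) < inner ℝ a r)
        have hlow : ∃ l : ℝ, 0 ≤ l ∧ (∀ p ∈ R, (0 : ℝ) < inner ℝ a p →
            (inner ℝ p η : ℝ) / inner ℝ a p ≤ l) ∧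
            ∀ r ∈ R, inner ℝ a r < (0 : ℝ) → l ≤ inner ℝ r η / inner ℝ a r := by
          have h0 : ∀ r ∈ R, inner ℝ a r < (0 : ℝ) → (0 : ℝ) ≤ inner ℝ r η / inner ℝ a r := by
            intro r hr hr0
            exact div_nonneg_of_nonpos (hη r (Or.inl ⟨hr, hr0.le⟩)) hr0.le
          let V : Finset ℝ := insert 0 (P.image fun p => (inner ℝ p η : ℝ) / inner ℝ a p)
          have hV : V.Nonempty := Finset.insert_nonempty _ _
          refine ⟨V.max' hV, V.le_max' _ (Finset.mem_insert_self _ _), ?_, ?_⟩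
          · intro p hp hp0
            apply V.le_max'
            apply Finset.mem_insert_of_mem
            apply Finset.mem_image_of_mem
            simp [P, hp, hp0]
          · intro r hr hr0
            apply V.max'_le
            intro v hv
            rcases Finset.mem_insert.1 hv with rfl | hv
            · exact h0 r hr hr0
            · obtain ⟨p, hp, rfl⟩ := Finset.mem_image.1 hv
              simp only [P, Finset.mem_filter, Set.Finite.mem_toFinset] at hp
              exact hneg r hr hr0 p hp.1 hp.2
        obtain ⟨l, hl0, hlp, hln⟩ := hlow
        refine ⟨l, hl0, fun r hr => ?_⟩
        rw [inner_sub_right, inner_smul_right, real_inner_comm a r]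
        rcases lt_trichotomy (inner ℝ a r : ℝ) 0 with h | h | h
        · have := hln r hr h
          rw [le_div_iff_of_neg h] at this
          linarith
        · have := hη r (Or.inl ⟨hr, h.le⟩)
          rw [h]; linarith
        · have := hlp r hr h
          rw [div_le_iff₀ h] at this
          linarith
      obtain ⟨l, hl0, hl⟩ := key
      intro z hz
      have h1 := hR hl z (fun b hb => hz b (Set.mem_insert_of_mem _ hb))
      have h2 := hz a (Set.mem_insert _ _)
      rw [inner_sub_right, inner_smul_right, real_inner_comm a z] at h1
      nlinarith

/-- The image of a polyhedral cone under a linear map is (sequentially) closed. -/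
lemma exists_mem_polarCone_of_tendsto [FiniteDimensional ℝ E] {F : Type*} [NormedAddCommGroup F]
    [NormedSpace ℝ F] {s : Set E} (hs : s.Finite) (A : E →L[ℝ] F) {z : ℕ → E} {b : F}
    (hz : ∀ k, z k ∈ polarCone s) (hb : Tendsto (fun k => A (z k)) atTop (𝓝 b)) :
    ∃ w ∈ polarCone s, A w = b := by
  -- Preimages of least norm cannot escape to infinity: a limit `v` of their normalizations would
  -- lie in the cone and in the kernel of `A`, and subtracting `v` would eventually give a shorter
  -- admissible preimage.
  have hmin : ∀ k, ∃ y ∈ polarCone s, A y = A (z k) ∧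
      ∀ y' ∈ polarCone s, A y' = A (z k) → ‖y‖ ≤ ‖y'‖ := by
    intro k
    have hcl : IsClosed (polarCone s ∩ {y | A y = A (z k)}) :=
      (isClosed_polarCone s).inter (isClosed_eq A.continuous continuous_const)
    obtain ⟨y, hy, hy'⟩ := hcl.exists_infDist_eq_dist ⟨z k, hz k, rfl⟩ 0
    refine ⟨y, hy.1, hy.2, fun y' h1 h2 => ?_⟩
    have := Metric.infDist_le_dist_of_mem (x := (0 : E)) 
      (show y' ∈ polarCone s ∩ {y | A y = A (z k)} from ⟨h1, h2⟩)
    rw [hy'] at this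
    simpa using this
  choose y hyS hyA hymin using hmin
  have hyb : Tendsto (fun k => A (y k)) atTop (𝓝 b) := by simpa only [hyA] using hb
  by_cases hbd : Tendsto (fun k => ‖y k‖) atTop atTop
  · exfalso
    have hn : ∀ᶠ k in atTop, 0 < ‖y k‖ := hbd.eventually_gt_atTop 0
    obtain ⟨v, -, φ, hφ, hv⟩ := tendsto_subseq_of_bounded (x := fun k => ‖y k‖⁻¹ • y k)
      (s := Metric.closedBall (0 : E) 1) Metric.isBounded_closedBall (by
        intro k
        rw [mem_closedBall_zero_iff, norm_smul, norm_inv, norm_norm]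
        exact inv_mul_le_one)
    have hbdφ : Tendsto (fun k => ‖y (φ k)‖) atTop atTop := hbd.comp hφ.tendsto_atTop
    have hnφ : ∀ᶠ k in atTop, 0 < ‖y (φ k)‖ := hbdφ.eventually_gt_atTop 0
    have hv1 : ‖v‖ = 1 := by
      refine tendsto_nhds_unique hv.norm (tendsto_const_nhds.congr' ?_)
      filter_upwards [hnφ] with k hk
      simp [norm_smul, hk.ne']
    have hAv : A v = 0 := by
      have h1 : Tendsto (fun k => A (‖y (φ k)‖⁻¹ • y (φ k))) atTop (𝓝 (A v)) :=
        (A.continuous.tendsto v).comp hv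
      have h2 : Tendsto (fun k => ‖y (φ k)‖⁻¹ • A (y (φ k))) atTop (𝓝 ((0 : ℝ) • b)) :=
        hbdφ.inv_tendsto_atTop.smul (hyb.comp hφ.tendsto_atTop)
      simp only [map_smul] at h1
      simpa using tendsto_nhds_unique h1 h2
    have hlim : ∀ a : E, Tendsto (fun k => ‖y (φ k)‖⁻¹ * (inner ℝ a (y (φ k)) : ℝ)) atTop
        (𝓝 (inner ℝ a v)) := by
      intro a
      have := (tendsto_const_nhds (x := a)).inner (𝕜 := ℝ) hv
      simpa only [Function.comp_def, inner_smul_right] using this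
    have hvS : v ∈ polarCone s := by
      intro a ha
      refine le_of_tendsto (hlim a) (Eventually.of_forall fun k => ?_)
      exact mul_nonpos_of_nonneg_of_nonpos (by positivity) (hyS _ a ha)
    have hinf : ∀ a : E, ∀ c : ℝ, (inner ℝ a v : ℝ) < 0 →
        ∀ᶠ k in atTop, (inner ℝ a (y (φ k)) : ℝ) < c := by
      intro a c hav
      have := (hlim a).neg_mul_atTop hav hbdφ
      filter_upwards [this.eventually_lt_atBot c, hnφ] with k hk hk0
      rwa [mul_comm, mul_inv_cancel_left₀ hk0.ne'] at hk
    -- Inequalities with `⟨a, v⟩ = 0` do not notice `v`; for the others `⟨a, y (φ k)⟩` tends to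
    -- `-∞`.
    have hmem : ∀ᶠ k in atTop, y (φ k) - v ∈ polarCone s := by
      have : ∀ a ∈ s, ∀ᶠ k in atTop, inner ℝ a (y (φ k) - v) ≤ (0 : ℝ) := by
        intro a ha
        rcases (hvS a ha).lt_or_eq with h | h
        · filter_upwards [hinf a _ h] with k hk
          rw [inner_sub_right]
          exact (sub_neg.2 hk).le
        · refine Eventually.of_forall fun k => ?_
          rw [inner_sub_right, h, sub_zero]
          exact hyS _ a ha
      exact (eventually_all_finite hs).2 this
    have hpos := hinf (-v) (-1) (by
      rw [inner_neg_left, real_inner_self_eq_norm_sq, hv1]; norm_num)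
    obtain ⟨k, hk, hk'⟩ := (hmem.and hpos).exists
    have h1 := hymin (φ k) _ hk (by rw [map_sub, hAv, sub_zero, hyA])
    have h2 : ‖y (φ k) - v‖ ^ 2 < ‖y (φ k)‖ ^ 2 := by
      rw [norm_sub_sq_real, hv1, real_inner_comm]
      rw [inner_neg_left] at hk'
      linarith
    exact absurd h1 (not_le.2 (lt_of_pow_lt_pow_left₀ 2 (norm_nonneg _) h2))
  · rw [tendsto_atTop] at hbd
    push Not at hbd
    obtain ⟨M, hM⟩ := hbd
    obtain ⟨w, -, φ, hφ, hw⟩ := tendsto_subseq_of_frequently_bounded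
      (x := y) (s := Metric.closedBall (0 : E) M) Metric.isBounded_closedBall (by
        refine hM.mono fun k hk => ?_
        rw [mem_closedBall_zero_iff]
        exact hk.le)
    refine ⟨w, (isClosed_polarCone s).mem_of_tendsto hw (Eventually.of_forall fun k => hyS _), ?_⟩
    exact tendsto_nhds_unique ((A.continuous.tendsto w).comp hw) (hyb.comp hφ.tendsto_atTop)

lemma mem_tangentCone_of_eventually {Q : Set E} {y z : E} (hy : y ∈ Q)
    (hev : ∀ᶠ s in 𝓝[>] (0 : ℝ), y + s • z ∈ Q) : z ∈ tangentCone Q y := by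
  obtain ⟨s, hs0, hs⟩ := (nhdsGT_basis (0 : ℝ)).eventually_iff.1 hev
  refine ⟨hy, fun _ => z, fun k => s / 2 / (k + 1), tendsto_const_nhds, fun k => by positivity,
    ?_, fun k => hs ⟨by positivity, ?_⟩⟩
  · exact ((tendsto_const_div_atTop_nhds_zero_nat (s / 2)).comp (tendsto_add_atTop_nat 1)).congr
      (by intro k; simp)
  · calc s / 2 / ((k : ℝ) + 1) ≤ s / 2 := div_le_self (by positivity) (by
          have : (0 : ℝ) ≤ k := k.cast_nonneg
          linarith)
      _ < s := by linarith

/-- The quotients satisfy the inequalities active at `y`, and these define a polyhedral cone, whose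
image is closed. A vector of that cone is tangent because the inactive inequalities survive small
steps. -/
lemma exists_mem_tangentCone_polarCone_of_tendsto [FiniteDimensional ℝ E] {F : Type*}
    [NormedAddCommGroup F] [NormedSpace ℝ F] {R : Set E} (hR : R.Finite) (A : E →L[ℝ] F)
    {y : E} (hy : y ∈ polarCone R) {yk : ℕ → E} (hyk : ∀ k, yk k ∈ polarCone R) {t : ℕ → ℝ}
    (ht : ∀ k, 0 < t k) {b : F} (hb : Tendsto (fun k => A ((t k)⁻¹ • (yk k - y))) atTop (𝓝 b)) :
    ∃ z ∈ tangentCone (polarCone R) y, A z = b := by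
  have hRf : {r ∈ R | inner ℝ r y = (0 : ℝ)}.Finite := hR.subset (Set.sep_subset _ _)
  obtain ⟨z, hz, hzb⟩ := exists_mem_polarCone_of_tendsto hRf A
    (z := fun k => (t k)⁻¹ • (yk k - y)) (by
      rintro k r ⟨hr, hr0⟩
      rw [inner_smul_right, inner_sub_right, hr0, sub_zero]
      exact mul_nonpos_of_nonneg_of_nonpos (inv_nonneg.2 (ht k).le) (hyk k r hr)) hb
  refine ⟨z, ⟨hy, ?_⟩, hzb⟩
  have hev : ∀ᶠ s in 𝓝[>] (0 : ℝ), y + s • z ∈ polarCone R := by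
    have : ∀ r ∈ R, ∀ᶠ s in 𝓝[>] (0 : ℝ), inner ℝ r (y + s • z) ≤ (0 : ℝ) := by
      intro r hr
      rcases (hy r hr).lt_or_eq with h | h
      · have hc : Tendsto (fun s : ℝ => (inner ℝ r (y + s • z) : ℝ)) (𝓝[>] 0)
            (𝓝 (inner ℝ r (y + (0 : ℝ) • z))) :=
          ((by fun_prop : Continuous fun s : ℝ => (inner ℝ r (y + s • z) : ℝ)).tendsto
            0).mono_left nhdsWithin_le_nhds
        rw [zero_smul, add_zero] at hc
        exact (hc.eventually_lt_const h).mono fun s hs => hs.le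
      · filter_upwards [self_mem_nhdsWithin] with s hs
        rw [inner_add_right, h, zero_add, inner_smul_right]
        exact mul_nonpos_of_nonneg_of_nonpos (le_of_lt hs) (hz r ⟨hr, h⟩)
    exact (eventually_all_finite hR).2 this
  exact (mem_tangentCone_of_eventually hy hev).2

end PolyhedralCones

/-! ### Sets that are unions of cells of a hyperplane arrangement. -/

section SignDetermined

variable {E : Type*} [NormedAddCommGroup E] [InnerProductSpace ℝ E] {ι : Type*}

/-- The vectors `d` and `d'` lie in the same cell of the hyperplane arrangement `a`. -/
def SameSigns (a : ι → E) (d d' : E) : Prop :=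
  ∀ i, SignType.sign (inner ℝ (a i) d : ℝ) = SignType.sign (inner ℝ (a i) d' : ℝ)

/-- The set `T` is a union of cells of the hyperplane arrangement `a`. -/
def IsSignDetermined (a : ι → E) (T : Set E) : Prop :=
  ∀ d d', SameSigns a d d' → d ∈ T → d' ∈ T

/-- Around `x`, the set `Q` is a union of cells of the hyperplane arrangement `a` translated
to `x`. -/
def IsLocallySignDetermined (a : ι → E) (Q : Set E) (x : E) : Prop :=
  ∃ ε > 0, ∀ d d', ‖d‖ < ε → ‖d'‖ < ε → SameSigns a d d' → x + d ∈ Q → x + d' ∈ Q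

lemma SameSigns.symm {a : ι → E} {d d' : E} (h : SameSigns a d d') : SameSigns a d' d :=
  fun i => (h i).symm

lemma SameSigns.trans {a : ι → E} {d d' d'' : E} (h : SameSigns a d d')
    (h' : SameSigns a d' d'') : SameSigns a d d'' :=
  fun i => (h i).trans (h' i)

lemma sameSigns_smul (a : ι → E) (d : E) {t : ℝ} (ht : 0 < t) : SameSigns a (t • d) d := by
  intro i
  rw [inner_smul_right, sign_mul, sign_pos ht, one_mul]

lemma smul_mem_tangentCone {Q : Set E} {x d : E} (hd : d ∈ tangentCone Q x) {s : ℝ}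
    (hs : 0 < s) : s • d ∈ tangentCone Q x := by
  obtain ⟨hx, dk, t, hdk, ht, ht0, hQ⟩ := hd
  refine ⟨hx, fun k => s • dk k, fun k => t k / s, hdk.const_smul s, fun k => div_pos (ht k) hs,
    by simpa using ht0.div_const s, fun k => ?_⟩
  rw [smul_smul, div_mul_cancel₀ _ hs.ne']
  exact hQ k

/-- Positive scaling does not leave a cell, so membership of `x + d` is inherited along the segment
from `x`; closedness of `Q` gives the converse for limits of directions. -/
lemma IsLocallySignDetermined.exists_mem_iff {a : ι → E} {Q : Set E} {x : E}
    (h : IsLocallySignDetermined a Q x) (hQ : IsClosed Q) (hx : x ∈ Q) :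
    ∃ ε > 0, ∀ d, ‖d‖ < ε → (x + d ∈ Q ↔ d ∈ tangentCone Q x) := by
  obtain ⟨ε, hε, h⟩ := h
  refine ⟨ε, hε, fun d hd => ⟨fun hdQ => ?_, fun hdT => ?_⟩⟩
  · refine mem_tangentCone_of_eventually hx ?_
    filter_upwards [Ioo_mem_nhdsGT (zero_lt_one' ℝ)] with s hs
    refine h d (s • d) hd ?_ (sameSigns_smul a d hs.1).symm hdQ
    rw [norm_smul, Real.norm_of_nonneg hs.1.le]
    exact (mul_le_of_le_one_left (norm_nonneg _) hs.2.le).trans_lt hd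
  · obtain ⟨-, dk, t, hdk, ht, ht0, hk⟩ := hdT
    refine hQ.mem_of_tendsto (hdk.const_add x) ?_
    have h1 : ∀ᶠ k in atTop, ‖dk k‖ < ε := hdk.norm.eventually_lt_const hd
    have h2 : ∀ᶠ k in atTop, ‖t k • dk k‖ < ε := by
      have := (ht0.smul hdk).norm
      rw [zero_smul, norm_zero] at this
      exact this.eventually_lt_const hε
    filter_upwards [h1, h2] with k hk1 hk2
    exact h _ _ hk2 hk1 (sameSigns_smul a _ (ht k)) (hk k)

lemma exists_pos_smul_norm_lt {ε : ℝ} (hε : 0 < ε) (d d' : E) :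
    ∃ s : ℝ, 0 < s ∧ ‖s • d‖ < ε ∧ ‖s • d'‖ < ε := by
  have : ∀ z : E, ∀ᶠ s in 𝓝[>] (0 : ℝ), ‖s • z‖ < ε := by
    intro z
    have hc : Tendsto (fun s : ℝ => ‖s • z‖) (𝓝[>] 0) (𝓝 ‖(0 : ℝ) • z‖) :=
      ((by fun_prop : Continuous fun s : ℝ => ‖s • z‖).tendsto 0).mono_left nhdsWithin_le_nhds
    rw [zero_smul, norm_zero] at hc
    exact hc.eventually_lt_const hε
  obtain ⟨s, hs, h1, h2⟩ :=
    ((eventually_mem_nhdsWithin (a := (0 : ℝ)) (s := Set.Ioi 0)).and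
      ((this d).and (this d'))).exists
  exact ⟨s, hs, h1, h2⟩

lemma IsLocallySignDetermined.isSignDetermined_tangentCone {a : ι → E} {Q : Set E} {x : E}
    (h : IsLocallySignDetermined a Q x) (hQ : IsClosed Q) :
    IsSignDetermined a (tangentCone Q x) := by
  intro d d' hdd hd
  obtain ⟨ε, hε, hT⟩ := h.exists_mem_iff hQ hd.1
  obtain ⟨r, hr, h⟩ := h
  obtain ⟨s, hs, h1, h2⟩ := exists_pos_smul_norm_lt (lt_min hε hr) d d'
  rw [lt_min_iff] at h1 h2
  have h3 := (hT _ h1.1).2 (smul_mem_tangentCone hd hs)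
  have h4 := (hT _ h2.1).1 (h _ _ h1.2 h2.2
    ((sameSigns_smul a d hs).trans (hdd.trans (sameSigns_smul a d' hs).symm)) h3)
  simpa [smul_smul, hs.ne'] using smul_mem_tangentCone h4 (inv_pos.2 hs)

lemma IsLocallySignDetermined.isClosed_tangentCone {a : ι → E} {Q : Set E} {x : E}
    (h : IsLocallySignDetermined a Q x) (hQ : IsClosed Q) : IsClosed (tangentCone Q x) := by
  by_cases hx : x ∈ Q
  swap
  · convert isClosed_empty (X := E)
    ext d
    exact ⟨fun hd => hx hd.1, fun hd => hd.elim⟩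
  obtain ⟨ε, hε, hT⟩ := h.exists_mem_iff hQ hx
  refine isClosed_of_closure_subset fun d hd => ?_
  obtain ⟨dk, hdk, hlim⟩ := mem_closure_iff_seq_limit.1 hd
  obtain ⟨s, hs, h1, -⟩ := exists_pos_smul_norm_lt hε d d
  have h2 : x + s • d ∈ Q := by
    refine hQ.mem_of_tendsto ((hlim.const_smul s).const_add x) ?_
    filter_upwards [(hlim.const_smul s).norm.eventually_lt_const h1] with k hk
    exact (hT _ hk).2 (smul_mem_tangentCone (hdk k) hs)
  simpa [smul_smul, hs.ne'] using smul_mem_tangentCone ((hT _ h1).1 h2) (inv_pos.2 hs)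

lemma eventually_sign_add (a x : E) (c : ℝ) :
    ∀ᶠ d in 𝓝 (0 : E), SignType.sign ((inner ℝ a (x + d) : ℝ) - c) =
      if (inner ℝ a x : ℝ) - c = 0 then SignType.sign (inner ℝ a d : ℝ)
      else SignType.sign ((inner ℝ a x : ℝ) - c) := by
  have hc : Tendsto (fun d : E => (inner ℝ a (x + d) : ℝ) - c) (𝓝 0)
      (𝓝 ((inner ℝ a (x + 0) : ℝ) - c)) :=
    (by fun_prop : Continuous fun d : E => (inner ℝ a (x + d) : ℝ) - c).tendsto 0
  rw [add_zero] at hc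
  rcases lt_trichotomy ((inner ℝ a x : ℝ) - c) 0 with h | h | h
  · filter_upwards [hc.eventually_lt_const h] with d hd
    rw [if_neg h.ne, sign_neg hd, sign_neg h]
  · refine Eventually.of_forall fun d => ?_
    rw [if_pos h, inner_add_right, add_sub_right_comm, h, zero_add]
  · filter_upwards [hc.eventually_const_lt h] with d hd
    rw [if_neg h.ne', sign_pos hd, sign_pos h]

/-- Near `x` only hyperplanes through `x` can change sign, so an affine arrangement acts there like
a central one. -/
lemma isLocallySignDetermined_of_affine [Finite ι] {a : ι → E} {c : ι → ℝ} {Q : Set E} {x : E}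
    {r : ℝ} (hr : 0 < r)
    (h : ∀ z ∈ Metric.ball x r, ∀ z' ∈ Metric.ball x r,
      (∀ i, SignType.sign ((inner ℝ (a i) z : ℝ) - c i) =
        SignType.sign ((inner ℝ (a i) z' : ℝ) - c i)) → z ∈ Q → z' ∈ Q) :
    IsLocallySignDetermined a Q x := by
  have := eventually_all.2 fun i => eventually_sign_add (a i) x (c i)
  obtain ⟨ε, hε, hs⟩ := Metric.eventually_nhds_iff.1 this
  simp only [dist_zero_right] at hs
  refine ⟨min ε r, lt_min hε hr, fun d d' hd hd' hdd hQ => ?_⟩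
  rw [lt_min_iff] at hd hd'
  refine h _ (by simpa using hd.2) _ (by simpa using hd'.2) (fun i => ?_) hQ
  rw [hs hd.1 i, hs hd'.1 i, hdd i]

lemma IsSignDetermined.locally [Finite ι] {a : ι → E} {T : Set E} (h : IsSignDetermined a T)
    (q : E) : IsLocallySignDetermined a T q :=
  isLocallySignDetermined_of_affine (c := 0) zero_lt_one fun z _ z' _ hs =>
    h z z' fun i => by simpa using hs i

/-- For small `s > 0` the signs of `q + s • d` depend only on those of `q` and `d`. Hence tangent
and regular normal cones are constant on cells. -/
lemma IsSignDetermined.tangentCone_subset [Finite ι] {a : ι → E} {T : Set E}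
    (h : IsSignDetermined a T) (hT : IsClosed T) {q q' : E} (hq : SameSigns a q q') :
    tangentCone T q ⊆ tangentCone T q' := by
  intro d hd
  have hq' := h _ _ hq hd.1
  obtain ⟨ε, hε, hm⟩ := (h.locally q).exists_mem_iff hT hd.1
  have hsm : Tendsto (fun s : ℝ => s • d) (𝓝[>] 0) (𝓝 0) := by
    have := ((by fun_prop : Continuous fun s : ℝ => s • d).tendsto 0).mono_left
      (nhdsWithin_le_nhds (s := Set.Ioi 0))
    rwa [zero_smul] at this
  have h1 := eventually_all.2 fun i => hsm.eventually (eventually_sign_add (a i) q 0)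
  have h2 := eventually_all.2 fun i => hsm.eventually (eventually_sign_add (a i) q' 0)
  have h3 : ∀ᶠ s : ℝ in 𝓝[>] 0, ‖s • d‖ < ε := by
    simpa using hsm.eventually (Metric.ball_mem_nhds 0 hε)
  refine mem_tangentCone_of_eventually hq' ?_
  filter_upwards [h1, h2, h3, self_mem_nhdsWithin] with s h1 h2 h3 hs
  refine h _ _ (fun i => ?_) ((hm _ h3).2 (smul_mem_tangentCone hd hs))
  have h1 := h1 i
  have h2 := h2 i
  simp only [sub_zero] at h1 h2
  have h0 : (inner ℝ (a i) q : ℝ) = 0 ↔ (inner ℝ (a i) q' : ℝ) = 0 := by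
    rw [← sign_eq_zero_iff, hq i, sign_eq_zero_iff]
  simp only [h1, h2, h0, hq i]

lemma regularNormalCone_eq_polarCone {Q : Set E} {x : E} {ε : ℝ} (hε : 0 < ε) (hx : x ∈ Q)
    (h : ∀ d, ‖d‖ < ε → (x + d ∈ Q ↔ d ∈ tangentCone Q x)) :
    regularNormalCone Q x = polarCone (tangentCone Q x) := by
  ext η
  constructor
  · rintro ⟨-, hη⟩ d hd
    refine le_of_forall_pos_le_add fun ρ hρ => ?_
    have hρ' : 0 < ρ / (‖d‖ + 1) := by positivity
    obtain ⟨r, hr, hη⟩ := Metric.eventually_nhds_iff.1 (eventually_nhdsWithin_iff.1 (hη _ hρ'))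
    obtain ⟨s, hs, h1, -⟩ := exists_pos_smul_norm_lt (lt_min hε hr) d d
    rw [lt_min_iff] at h1
    have h2 := hη (y := x + s • d) (by simpa using h1.2)
      ((h _ h1.1).2 (smul_mem_tangentCone hd hs))
    rw [add_sub_cancel_left, inner_smul_right, norm_smul, Real.norm_of_nonneg hs.le] at h2
    have h3 : inner ℝ η d ≤ ρ / (‖d‖ + 1) * ‖d‖ := by
      refine le_of_mul_le_mul_left ?_ hs
      linarith
    have h4 : ρ / (‖d‖ + 1) * ‖d‖ ≤ ρ := by
      rw [div_mul_eq_mul_div, div_le_iff₀ (by positivity)]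
      nlinarith
    rw [real_inner_comm]
    linarith
  · intro hη
    refine ⟨hx, fun ρ hρ => ?_⟩
    rw [eventually_nhdsWithin_iff]
    filter_upwards [Metric.ball_mem_nhds x hε] with z hz hzQ
    have h1 := hη (z - x) ((h (z - x) (by simpa [dist_eq_norm] using hz)).1 (by simpa using hzQ))
    rw [real_inner_comm]
    exact h1.trans (by positivity)

lemma IsSignDetermined.regularNormalCone_eq [Finite ι] {a : ι → E} {T : Set E}
    (h : IsSignDetermined a T) (hT : IsClosed T) {q q' : E} (hq : SameSigns a q q') :
    regularNormalCone T q = regularNormalCone T q' := by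
  by_cases hqT : q ∈ T
  · have hqT' := h _ _ hq hqT
    obtain ⟨ε, hε, hm⟩ := (h.locally q).exists_mem_iff hT hqT
    obtain ⟨ε', hε', hm'⟩ := (h.locally q').exists_mem_iff hT hqT'
    rw [regularNormalCone_eq_polarCone hε hqT hm, regularNormalCone_eq_polarCone hε' hqT' hm',
      (h.tangentCone_subset hT hq).antisymm (h.tangentCone_subset hT hq.symm)]
  · have hqT' : q' ∉ T := fun h' => hqT (h _ _ hq.symm h')
    ext η
    exact ⟨fun hη => absurd hη.1 hqT, fun hη => absurd hη.1 hqT'⟩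

/-- The set of inequalities that describes the closure of the cell of `q`. -/
def cellInequalities (a : ι → E) (q : E) : Set E :=
  (fun p : Bool × ι => if p.1 then a p.2 else -a p.2) ''
    {p | if p.1 then (inner ℝ (a p.2) q : ℝ) ≤ 0 else (0 : ℝ) ≤ inner ℝ (a p.2) q}

lemma finite_cellInequalities [Finite ι] (a : ι → E) (q : E) : (cellInequalities a q).Finite :=
  (Set.toFinite _).image _

lemma mem_polarCone_cellInequalities {a : ι → E} {q z : E} :
    z ∈ polarCone (cellInequalities a q) ↔ ∀ i,
      ((inner ℝ (a i) q : ℝ) ≤ 0 → (inner ℝ (a i) z : ℝ) ≤ 0) ∧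
        ((0 : ℝ) ≤ inner ℝ (a i) q → (0 : ℝ) ≤ inner ℝ (a i) z) := by
  simp only [polarCone, cellInequalities, Set.forall_mem_image, Set.mem_ofPred_eq, Prod.forall,
    Bool.forall_bool, if_true, inner_neg_left, Bool.false_eq_true, if_false, neg_nonpos]
  exact ⟨fun h i => ⟨h.2 i, h.1 i⟩, fun h => ⟨fun i => (h i).2, fun i => (h i).1⟩⟩

lemma SameSigns.mem_polarCone {a : ι → E} {q z : E} (h : SameSigns a q z) :
    z ∈ polarCone (cellInequalities a q) := by
  refine mem_polarCone_cellInequalities.2 fun i => ⟨fun hi => ?_, fun hi => ?_⟩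
  · rwa [← sign_nonpos_iff, ← h i, sign_nonpos_iff]
  · rwa [← sign_nonneg_iff, ← h i, sign_nonneg_iff]

lemma sameSigns_add_smul {a : ι → E} {q z : E} (hz : z ∈ polarCone (cellInequalities a q))
    {s : ℝ} (hs : 0 < s) : SameSigns a q (z + s • q) := by
  intro i
  have h := mem_polarCone_cellInequalities.1 hz i
  rw [inner_add_right, inner_smul_right]
  rcases lt_trichotomy (inner ℝ (a i) q : ℝ) 0 with hi | hi | hi
  · have := h.1 hi.le
    rw [sign_neg hi, sign_neg (by nlinarith)]
  · have h1 := h.1 hi.le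
    have h2 := h.2 hi.ge
    rw [hi, le_antisymm h1 h2]
    simp
  · have := h.2 hi.le
    rw [sign_pos hi, sign_pos (by nlinarith)]

lemma tendsto_add_inv_smul (z q : E) :
    Tendsto (fun k : ℕ => z + (1 / ((k : ℝ) + 1)) • q) atTop (𝓝 z) := by
  simpa using ((tendsto_one_div_add_atTop_nhds_zero_nat (𝕜 := ℝ)).smul_const q).const_add z

lemma IsSignDetermined.exists_finite_polarCone_eq [Finite ι] [FiniteDimensional ℝ E] {a : ι → E}
    {C : Set E} (h : IsSignDetermined a C) (hC : IsClosed C) :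
    ∃ R : Set E, R.Finite ∧ polarCone C = polarCone R := by
  have hfin : (cellInequalities a '' C).Finite := by
    refine Set.Finite.subset (s := (fun S : Set (Bool × ι) =>
      (fun p : Bool × ι => if p.1 then a p.2 else -a p.2) '' S) '' Set.univ)
      ((Set.toFinite _).image _) ?_
    rintro _ ⟨q, -, rfl⟩
    exact ⟨_, trivial, rfl⟩
  have hgen : ∀ q : E, ∃ R ⊆ polarCone (cellInequalities a q), R.Finite ∧
      polarCone R ⊆ polarCone (polarCone (cellInequalities a q)) :=
    fun q => exists_finite_generators (finite_cellInequalities a q)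
  have hgen' : ∀ S ∈ cellInequalities a '' C, ∃ R ⊆ polarCone S, R.Finite ∧
      polarCone R ⊆ polarCone (polarCone S) := by
    rintro _ ⟨q, -, rfl⟩
    exact hgen q
  choose! G hG1 hG2 hG3 using hgen'
  -- `C` is a finite union of closed cells, each a polyhedral cone; the union of their generators
  -- determines the polar of `C`.
  refine ⟨⋃ S ∈ cellInequalities a '' C, G S, hfin.biUnion hG2, Set.Subset.antisymm ?_ ?_⟩
  · intro η hη r hr
    simp only [Set.mem_iUnion] at hr
    obtain ⟨S, hS, hrS⟩ := hr
    have hrS' := hG1 S hS hrS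
    obtain ⟨q, hq, rfl⟩ := hS
    refine hη r (hC.mem_of_tendsto (tendsto_add_inv_smul r q) (Eventually.of_forall fun k => ?_))
    exact h _ _ (sameSigns_add_smul hrS' (by positivity)) hq
  · intro η hη d hd
    refine hG3 (cellInequalities a d) ⟨d, hd, rfl⟩ (fun r hr => hη r ?_) d
      (SameSigns.mem_polarCone fun i => rfl)
    exact Set.mem_biUnion ⟨d, hd, rfl⟩ hr

/-- Regular normal cones to sign-determined sets are polyhedral. -/
lemma IsSignDetermined.exists_finite_regularNormalCone_eq [Finite ι] [FiniteDimensional ℝ E]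
    {a : ι → E} {T : Set E} (h : IsSignDetermined a T) (hT : IsClosed T) {q : E} (hq : q ∈ T) :
    ∃ R : Set E, R.Finite ∧ regularNormalCone T q = polarCone R := by
  obtain ⟨ε, hε, hm⟩ := (h.locally q).exists_mem_iff hT hq
  rw [regularNormalCone_eq_polarCone hε hq hm]
  exact ((h.locally q).isSignDetermined_tangentCone hT).exists_finite_polarCone_eq
    ((h.locally q).isClosed_tangentCone hT)

/-- Both sides of the inequality defining a regular normal scale by `t`. -/
lemma regularNormalCone_affine {Q T : Set E} {x q : E} {t : ℝ} (ht : 0 < t)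
    (h : ∀ᶠ z in 𝓝 q, (x + t • z ∈ Q ↔ z ∈ T)) :
    regularNormalCone Q (x + t • q) = regularNormalCone T q := by
  have hmap : 𝓝 (x + t • q) = map (fun z => x + t • z) (𝓝 q) :=
    (((Homeomorph.smulOfNeZero t ht.ne').trans (Homeomorph.addLeft x)).map_nhds_eq q).symm
  have hiff : ∀ η : E, (∀ ε > 0, ∀ᶠ x' in 𝓝[Q] (x + t • q),
      inner ℝ η (x' - (x + t • q)) ≤ ε * ‖x' - (x + t • q)‖) ↔
      ∀ ε > 0, ∀ᶠ x' in 𝓝[T] q, inner ℝ η (x' - q) ≤ ε * ‖x' - q‖ := by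
    intro η
    refine forall₂_congr fun ε _ => ?_
    rw [eventually_nhdsWithin_iff, eventually_nhdsWithin_iff, hmap, eventually_map]
    refine eventually_congr (h.mono fun z hz => ?_)
    rw [hz, add_sub_add_left_eq_sub, ← smul_sub, inner_smul_right, norm_smul,
      Real.norm_of_nonneg ht.le, mul_left_comm, mul_le_mul_iff_right₀ ht]
  ext η
  exact and_congr h.self_of_nhds (hiff η)

lemma exists_sameSigns_subseq [Finite ι] (a : ι → E) (q : ℕ → E) :
    ∃ φ : ℕ → ℕ, StrictMono φ ∧ ∀ k, SameSigns a (q (φ 0)) (q (φ k)) := by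
  have : Finite (ι → SignType) := inferInstance
  obtain ⟨σ, hσ⟩ := Finite.exists_infinite_fiber
    (fun k i => SignType.sign (inner ℝ (a i) (q k) : ℝ))
  have hinf := Set.infinite_coe_iff.1 hσ
  refine ⟨Nat.nth (· ∈ (fun k i => SignType.sign (inner ℝ (a i) (q k) : ℝ)) ⁻¹' {σ}),
    Nat.nth_strictMono hinf, fun k i => ?_⟩
  have h0 := Nat.nth_mem_of_infinite hinf 0
  have hk := Nat.nth_mem_of_infinite hinf k
  exact congrFun (h0.trans hk.symm) i

end SignDetermined

/-! ### From locally polyhedral sets to hyperplane arrangements. -/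

section LocallyPolyhedral

variable {Y : Type*} [NormedAddCommGroup Y] [InnerProductSpace ℝ Y]

lemma IsLocallyPolyhedral.exists_isLocallySignDetermined {m : ℕ}
    {e : OrthonormalBasis (Fin m) ℝ Y} {Q : Set Y} {x : Y} (h : IsLocallyPolyhedral e Q x) :
    ∃ (n : ℕ) (a : Fin n → Y), IsLocallySignDetermined a Q x := by
  obtain ⟨ε, hε, n, P, hP, hQ⟩ := h
  choose l a c hP using hP
  let f := Fintype.equivFin ((i : Fin n) × Fin (l i))
  refine ⟨_, fun j => a (f.symm j).1 (f.symm j).2, ?_⟩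
  have hmem : ∀ z ∈ Metric.ball x ε,
      (z ∈ Q ↔ ∃ i, ∀ j, SignType.sign ((inner ℝ (a i j) z : ℝ) - c i j) ≤ 0) := by
    intro z hz
    -- The ball of radius `ε` lies inside the cube, so the cube's own faces need not enter the
    -- arrangement.
    have hcube : z ∈ {z | ∀ i, |e.repr z i - e.repr x i| ≤ ε} := by
      intro i
      rw [← PiLp.sub_apply, ← map_sub, ← Real.norm_eq_abs]
      refine (PiLp.norm_apply_le _ i).trans ?_
      rw [e.repr.norm_map, ← dist_eq_norm]
      exact (Metric.mem_ball.1 hz).le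
    have h1 : z ∈ Q ↔ z ∈ ⋃ i, P i := by
      rw [← hQ]
      exact ⟨fun h => ⟨h, hcube⟩, fun h => h.1⟩
    simp only [h1, Set.mem_iUnion, hP, Set.mem_ofPred_eq, sign_nonpos_iff, sub_nonpos]
  refine isLocallySignDetermined_of_affine (c := fun j => c (f.symm j).1 (f.symm j).2) hε
    fun z hz z' hz' hs hzQ => ?_
  rw [hmem z hz] at hzQ
  rw [hmem z' hz']
  obtain ⟨i, hi⟩ := hzQ
  refine ⟨i, fun j => ?_⟩
  have := hs (f ⟨i, j⟩)
  rw [f.symm_apply_apply] at this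
  rw [← this]
  exact hi j

end LocallyPolyhedral

/-! ### Projections, penalization and approximate stationarity. -/

lemma smul_sub_mem_regularNormalCone {Y : Type*} [NormedAddCommGroup Y]
    [InnerProductSpace ℝ Y] {D : Set Y} {p y : Y} (hy : y ∈ D)
    (hmin : ∀ y' ∈ D, ‖p - y‖ ≤ ‖p - y'‖) (hpy : p ≠ y) :
    ‖p - y‖⁻¹ • (p - y) ∈ regularNormalCone D y := by
  have hpos : 0 < ‖p - y‖ := norm_pos_iff.2 (sub_ne_zero.2 hpy)
  refine ⟨hy, fun ε hε => ?_⟩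
  rw [eventually_nhdsWithin_iff]
  filter_upwards [Metric.ball_mem_nhds y (by positivity : 0 < 2 * ε * ‖p - y‖)] with z hz hzD
  have h1 := hmin z hzD
  have h2 : ‖p - z‖ ^ 2 = ‖p - y‖ ^ 2 - 2 * inner ℝ (p - y) (z - y) + ‖z - y‖ ^ 2 := by
    rw [← norm_sub_sq_real, sub_sub_sub_cancel_right]
  have h3 : ‖p - y‖ ^ 2 ≤ ‖p - z‖ ^ 2 := by gcongr
  rw [Metric.mem_ball, dist_eq_norm] at hz
  rw [real_inner_smul_left, inv_mul_le_iff₀ hpos]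
  nlinarith [norm_nonneg (z - y)]

lemma infEDist_constraintMap {X Y : Type*} [NormedAddCommGroup Y] (g : X → Y) (D : Set Y) (x : X) :
    Metric.infEDist 0 (constraintMap g D x) = Metric.infEDist (g x) D := by
  have h1 : constraintMap g D x = IsometryEquiv.subLeft (g x) '' D := by
    ext y
    simp [constraintMap, eq_comm]
  have h2 : (0 : Y) = IsometryEquiv.subLeft (g x) (g x) := by simp
  rw [h1, h2]
  exact Metric.infEDist_image (IsometryEquiv.subLeft (g x)).isometry

/-- The constant `n ^ 2` is spent later in two factors: one `n` shrinks the search radius, the other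
the penalty slope. -/
lemma exists_far_point {X Y : Type*} [NormedAddCommGroup X] [InnerProductSpace ℝ X]
    [NormedAddCommGroup Y] {g : X → Y} {D : Set Y} {xb u : X} (hxb : g xb ∈ D) (hu : ‖u‖ = 1)
    (hnot : ¬ IsMetricallyPseudoSubregular 2 (constraintMap g D) xb 0 u) {n : ℝ} (hn : 0 < n) :
    ∃ v : X, 0 < ‖v‖ ∧ ‖v‖ ≤ 1 / n ∧ ‖‖v‖⁻¹ • v - u‖ ≤ 1 / n ∧
      0 < Metric.infDist (xb + v) (g ⁻¹' D) ∧
      n ^ 2 * Metric.infDist (g (xb + v)) D ≤ ‖v‖ * Metric.infDist (xb + v) (g ⁻¹' D) := by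
  unfold IsMetricallyPseudoSubregular at hnot
  push Not at hnot
  obtain ⟨v, ⟨hv1, hv2⟩, hv⟩ := hnot (1 / n) (by positivity) (1 / n) (by positivity) (n ^ 2)
    (by positivity)
  have hset : {x | (0 : Y) ∈ constraintMap g D x} = g ⁻¹' D := by
    ext x
    simp only [constraintMap, Set.mem_ofPred_eq, Set.mem_preimage]
    constructor
    · rintro ⟨d, hd, h⟩
      rwa [sub_eq_zero.1 h.symm]
    · exact fun h => ⟨_, h, (sub_self _).symm⟩
  rw [hset, infEDist_constraintMap, add_sub_cancel_left] at hv
  have e1 : Metric.infEDist (xb + v) (g ⁻¹' D) =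
      ENNReal.ofReal (Metric.infDist (xb + v) (g ⁻¹' D)) :=
    (ENNReal.ofReal_toReal (Metric.infEDist_ne_top ⟨xb, hxb⟩)).symm
  have e2 : Metric.infEDist (g (xb + v)) D = ENNReal.ofReal (Metric.infDist (g (xb + v)) D) :=
    (ENNReal.ofReal_toReal (Metric.infEDist_ne_top ⟨_, hxb⟩)).symm
  rw [e1, e2, ← ENNReal.ofReal_mul (by positivity), ← ENNReal.ofReal_mul (by positivity),
    ENNReal.ofReal_lt_ofReal_iff_of_nonneg (mul_nonneg (by positivity) Metric.infDist_nonneg)] at hv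
  have h2 : (2 : ℝ) - 1 = 1 := by norm_num
  rw [h2, Real.rpow_one] at hv
  have hpos : 0 < ‖v‖ * Metric.infDist (xb + v) (g ⁻¹' D) :=
    lt_of_le_of_lt (mul_nonneg (by positivity) Metric.infDist_nonneg) hv
  have hv0 : 0 < ‖v‖ := pos_of_mul_pos_left hpos Metric.infDist_nonneg
  refine ⟨v, hv0, hv2, ?_, pos_of_mul_pos_right hpos hv0.le, hv.le⟩
  rw [hu, one_smul, mul_one] at hv1
  have h3 : ‖v‖⁻¹ • v - u = -(‖v‖⁻¹ • (‖v‖ • u - v)) := by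
    rw [smul_sub, smul_smul, inv_mul_cancel₀ hv0.ne', one_smul, neg_sub]
  rw [h3, norm_neg, norm_smul, norm_inv, norm_norm, inv_mul_le_iff₀ hv0, mul_comm]
  exact hv1

section Penalization

variable {X Y : Type*} [NormedAddCommGroup X] [InnerProductSpace ℝ X] [FiniteDimensional ℝ X]
  [NormedAddCommGroup Y] [InnerProductSpace ℝ Y] [FiniteDimensional ℝ Y]

/-- Since `g x ≠ y`, the norm is differentiable there; test the first-order condition in the
direction of steepest descent. -/
lemma norm_adjDeriv_le {g : X → Y} {x : X} (hg : DifferentiableAt ℝ g x) {y : Y}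
    (hy : g x ≠ y) {l : ℝ} (hl : 0 ≤ l)
    (hmin : ∀ᶠ x' in 𝓝 x, ‖g x - y‖ ≤ ‖g x' - y‖ + l * ‖x' - x‖) :
    ‖adjDeriv g x (‖g x - y‖⁻¹ • (g x - y))‖ ≤ l := by
  have hne : g x - y ≠ 0 := sub_ne_zero.2 hy
  have hpos : 0 < ‖g x - y‖ := norm_pos_iff.2 hne
  set η := ‖g x - y‖⁻¹ • (g x - y) with hη
  have hdir : ∀ v : X, -(l * ‖v‖) ≤ inner ℝ η (fderiv ℝ g x v) := by
    intro v
    have hline : HasDerivAt (fun s : ℝ => x + s • v) v 0 := by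
      simpa using ((hasDerivAt_id (0 : ℝ)).smul_const v).const_add x
    have hgl : HasDerivAt (fun s : ℝ => g (x + s • v) - y) (fderiv ℝ g x v) 0 := by
      have h0 : HasFDerivAt g (fderiv ℝ g x) (x + (0 : ℝ) • v) := by
        simpa using hg.hasFDerivAt
      exact (h0.comp_hasDerivAt (0 : ℝ) hline).sub_const y
    have hN := hgl.norm_sq.sqrt (by simpa using hne)
    simp only [Real.sqrt_sq (norm_nonneg _), zero_smul, add_zero] at hN
    have hval : 2 * inner ℝ (g x - y) (fderiv ℝ g x v) / (2 * ‖g x - y‖) =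
        inner ℝ η (fderiv ℝ g x v) := by
      rw [hη, real_inner_smul_left]
      field_simp
    rw [hval] at hN
    have hslope := (hasDerivAt_iff_tendsto_slope_zero.1 hN).mono_left
      (nhdsWithin_mono (0 : ℝ) (fun s (hs : s ∈ Set.Ioi 0) => (Set.mem_Ioi.1 hs).ne'))
    have hcont : Tendsto (fun s : ℝ => x + s • v) (𝓝[>] 0) (𝓝 x) := by
      simpa using hline.continuousAt.tendsto.mono_left (nhdsWithin_le_nhds (s := Set.Ioi 0))
    refine ge_of_tendsto hslope ?_
    filter_upwards [hcont.eventually hmin, self_mem_nhdsWithin] with s hs (hs0 : 0 < s)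
    rw [add_sub_cancel_left, norm_smul, Real.norm_of_nonneg hs0.le] at hs
    simp only [zero_add, zero_smul, add_zero, smul_eq_mul]
    rw [inv_mul_eq_div, le_div_iff₀ hs0]
    linarith
  have h := hdir (-adjDeriv g x η)
  rw [norm_neg, map_neg, inner_neg_right] at h
  have h2 : inner ℝ η (fderiv ℝ g x (adjDeriv g x η)) = ‖adjDeriv g x η‖ ^ 2 := by
    rw [← ContinuousLinearMap.adjoint_inner_left, ← real_inner_self_eq_norm_sq]
    rfl
  rw [h2] at h
  by_contra! hlt
  nlinarith

lemma exists_approx_stationary {g : X → Y} (hg : Differentiable ℝ g) {D : Set Y}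
    (hD : IsClosed D) (hDne : D.Nonempty) {x₀ : X} {ρ l : ℝ} (hl : 0 < l) (hρ : 0 ≤ ρ)
    (hx₀ : ∀ x, ‖x - x₀‖ ≤ ρ → g x ∉ D) (hdist : Metric.infDist (g x₀) D ≤ l * ρ) :
    ∃ (x : X) (y η : Y), ‖x - x₀‖ ≤ ρ ∧ ‖g x - y‖ ≤ l * ρ ∧ η ∈ regularNormalCone D y ∧
      ‖η‖ = 1 ∧ ‖adjDeriv g x η‖ ≤ l := by
  let F : X → ℝ := fun x => Metric.infDist (g x) D + l * ‖x - x₀‖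
  have hF : Continuous F :=
    ((Metric.continuous_infDist_pt D).comp hg.continuous).add (by fun_prop)
  -- The extra radius `1` makes the minimizer interior: comparison with `x₀` puts it within `ρ`.
  obtain ⟨x, -, hxmin⟩ := (isCompact_closedBall x₀ (ρ + 1)).exists_isMinOn
    ⟨x₀, Metric.mem_closedBall_self (by linarith)⟩ hF.continuousOn
  have hmin : ∀ x', ‖x' - x₀‖ ≤ ρ + 1 → F x ≤ F x' := fun x' hx' =>
    hxmin (by simpa [dist_eq_norm] using hx')
  have hFx : F x ≤ l * ρ := by
    refine (hmin x₀ (by simp; linarith)).trans ?_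
    simpa [F] using hdist
  have hd0 : 0 ≤ Metric.infDist (g x) D := Metric.infDist_nonneg
  have hxρ : ‖x - x₀‖ ≤ ρ := by
    refine le_of_mul_le_mul_left ?_ hl
    simp only [F] at hFx
    linarith
  obtain ⟨y, hyD, hy⟩ := hD.exists_infDist_eq_dist hDne (g x)
  rw [dist_eq_norm] at hy
  have hne : g x ≠ y := fun h => hx₀ x hxρ (h ▸ hyD)
  have hpos : 0 < ‖g x - y‖ := norm_pos_iff.2 (sub_ne_zero.2 hne)
  refine ⟨x, y, ‖g x - y‖⁻¹ • (g x - y), hxρ, ?_, smul_sub_mem_regularNormalCone hyD ?_ hne, ?_,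
    norm_adjDeriv_le (hg x) hne hl.le ?_⟩
  · rw [← hy]
    simp only [F] at hFx
    have : 0 ≤ l * ‖x - x₀‖ := by positivity
    linarith
  · intro y' hy'
    rw [← hy, ← dist_eq_norm]
    exact Metric.infDist_le_dist_of_mem hy'
  · rw [norm_smul, norm_inv, norm_norm, inv_mul_cancel₀ hpos.ne']
  · filter_upwards [Metric.ball_mem_nhds x zero_lt_one] with x' hx'
    rw [Metric.mem_ball, dist_eq_norm] at hx'
    have h1 : ‖x' - x₀‖ ≤ ‖x' - x‖ + ‖x - x₀‖ := by
      simpa using norm_add_le (x' - x) (x - x₀)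
    have h2 := hmin x' (by linarith)
    have h3 : Metric.infDist (g x') D ≤ ‖g x' - y‖ := by
      rw [← dist_eq_norm]
      exact Metric.infDist_le_dist_of_mem hyD
    simp only [F] at h2
    have h4 := mul_le_mul_of_nonneg_left h1 hl.le
    linarith

/-- If metric pseudo-subregularity of order 2 fails, then there is a sequence of points that are
asymptotically stationary of order 2. -/
lemma exists_asymptotic_sequences {g : X → Y} (hg : Differentiable ℝ g) {D : Set Y}
    (hD : IsClosed D) {xb u : X} (hxb : g xb ∈ D) (hu : ‖u‖ = 1)
    (hnot : ¬ IsMetricallyPseudoSubregular 2 (constraintMap g D) xb 0 u) :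
    ∃ (t : ℕ → ℝ) (uk : ℕ → X) (yk ηk : ℕ → Y) (η : Y), (∀ k, 0 < t k) ∧
      Tendsto t atTop (𝓝 0) ∧ Tendsto uk atTop (𝓝 u) ∧
      (∀ k, ηk k ∈ regularNormalCone D (yk k)) ∧ ‖η‖ = 1 ∧ Tendsto ηk atTop (𝓝 η) ∧
      Tendsto (fun k => (t k ^ 2)⁻¹ • (g (xb + t k • uk k) - yk k)) atTop (𝓝 0) ∧
      Tendsto (fun k => (t k)⁻¹ • adjDeriv g (xb + t k • uk k) (ηk k)) atTop (𝓝 0) := by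
  have hstep : ∀ k : ℕ, ∃ (t : ℝ) (u' : X) (y η : Y), 0 < t ∧ t ≤ 1 / ((k : ℝ) + 2) ∧
      ‖u' - u‖ ≤ 2 * (1 / ((k : ℝ) + 2)) ∧ η ∈ regularNormalCone D y ∧ ‖η‖ = 1 ∧
      ‖(t ^ 2)⁻¹ • (g (xb + t • u') - y)‖ ≤ 1 / ((k : ℝ) + 2) ∧
      ‖t⁻¹ • adjDeriv g (xb + t • u') η‖ ≤ 1 / ((k : ℝ) + 2) := by
    intro k
    -- The shift by `2` ensures `d / n < d`, so the search ball contains no feasible point.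
    set n : ℝ := (k : ℝ) + 2 with hn_def
    have hn2 : 2 ≤ n := by
      have : (0 : ℝ) ≤ k := k.cast_nonneg
      linarith
    have hn : 0 < n := by linarith
    obtain ⟨v, hv0, hvn, hvu, hd0, hv⟩ := exists_far_point hxb hu hnot hn
    set d := Metric.infDist (xb + v) (g ⁻¹' D) with hd_def
    have hdv : d ≤ ‖v‖ := by
      have := Metric.infDist_le_dist_of_mem (x := xb + v) (show xb ∈ g ⁻¹' D from hxb)
      simpa using this
    obtain ⟨x, y, η, h1, h2, h3, h4, h5⟩ := exists_approx_stationary hg hD ⟨_, hxb⟩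
      (x₀ := xb + v) (ρ := d / n) (l := ‖v‖ / n) (by positivity) (by positivity)
      (by
        intro x hx hxD
        have h1 : d ≤ ‖x - (xb + v)‖ := by
          rw [← dist_eq_norm, dist_comm]
          exact Metric.infDist_le_dist_of_mem hxD
        have h2 : d / n < d := div_lt_self hd0 (by linarith)
        linarith)
      (by
        rw [div_mul_div_comm, le_div_iff₀ (by positivity)]
        linarith)
    have hx : xb + ‖v‖ • (‖v‖⁻¹ • (x - xb)) = x := by
      rw [smul_smul, mul_inv_cancel₀ hv0.ne', one_smul, add_sub_cancel]
    refine ⟨‖v‖, ‖v‖⁻¹ • (x - xb), y, η, hv0, hvn, ?_, h3, h4, ?_, ?_⟩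
    · have e : ‖v‖⁻¹ • (x - xb) - u = ‖v‖⁻¹ • (x - (xb + v)) + (‖v‖⁻¹ • v - u) := by
        simp only [smul_sub, smul_add]
        abel
      have h6 : ‖‖v‖⁻¹ • (x - (xb + v))‖ ≤ 1 / n := by
        rw [norm_smul, norm_inv, norm_norm, inv_mul_le_iff₀ hv0, mul_one_div]
        exact h1.trans (by gcongr)
      rw [e]
      exact (norm_add_le _ _).trans (by linarith)
    · rw [hx, norm_smul, norm_inv, Real.norm_of_nonneg (by positivity),
        inv_mul_le_iff₀ (by positivity)]
      refine h2.trans ?_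
      rw [div_mul_div_comm, mul_one_div]
      gcongr
      · rw [pow_two]
        gcongr
      · nlinarith
    · rw [hx, norm_smul, norm_inv, norm_norm, inv_mul_le_iff₀ hv0, mul_one_div]
      exact h5
  choose t uk yk ηk ht htn hukn hηN hη1 hgn han using hstep
  have hlim : Tendsto (fun k : ℕ => 1 / ((k : ℝ) + 2)) atTop (𝓝 0) :=
    ((tendsto_one_div_add_atTop_nhds_zero_nat (𝕜 := ℝ)).comp (tendsto_add_atTop_nat 1)).congr
      (by intro k; simp; ring)
  obtain ⟨η, hη, φ, hφ, hlimη⟩ := (isCompact_sphere (0 : Y) 1).tendsto_subseq (x := ηk)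
    (fun k => by simpa using hη1 k)
  have hlimφ := hlim.comp hφ.tendsto_atTop
  refine ⟨t ∘ φ, uk ∘ φ, yk ∘ φ, ηk ∘ φ, η, fun k => ht _, ?_, ?_, fun k => hηN _,
    by simpa using hη, hlimη, ?_, ?_⟩
  · exact squeeze_zero (fun k => (ht _).le) (fun k => htn _) hlimφ
  · rw [tendsto_iff_norm_sub_tendsto_zero]
    refine squeeze_zero (fun k => norm_nonneg _) (fun k => hukn _) ?_
    simpa using hlimφ.const_mul 2
  · exact squeeze_zero_norm (fun k => hgn _) hlimφ
  · exact squeeze_zero_norm (fun k => han _) hlimφ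

end Penalization

/-! ### Second-order expansions. -/

/-- By symmetry of the second derivative, the remainder has derivative `o(‖x - xb‖)`; the mean value
inequality on a ball adds the second factor. -/
lemma isLittleO_taylor_two {X Y : Type*} [NormedAddCommGroup X] [NormedSpace ℝ X]
    [NormedAddCommGroup Y] [NormedSpace ℝ Y] {g : X → Y} (hg : ContDiff ℝ 2 g) (xb : X) :
    (fun x => g x - g xb - fderiv ℝ g xb (x - xb) -
      (1 / 2 : ℝ) • fderiv ℝ (fderiv ℝ g) xb (x - xb) (x - xb)) =o[𝓝 xb]
      fun x => ‖x - xb‖ ^ 2 := by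
  set H := fderiv ℝ (fderiv ℝ g) xb with hH
  have hsymm : ∀ v w, H v w = H w v :=
    (hg.contDiffAt (x := xb)).isSymmSndFDerivAt (by simp)
  have hd : HasFDerivAt (fderiv ℝ g) H xb :=
    (((hg.fderiv_right (m := 1) (by norm_num)).differentiable (by norm_num)) xb).hasFDerivAt
  have hder : ∀ x, HasFDerivAt (fun x => g x - g xb - fderiv ℝ g xb (x - xb) -
      (1 / 2 : ℝ) • H (x - xb) (x - xb)) (fderiv ℝ g x - fderiv ℝ g xb - H (x - xb)) x := by
    intro x
    have h1 : HasFDerivAt g (fderiv ℝ g x) x := (hg.differentiable (by norm_num) x).hasFDerivAt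
    have h0 : HasFDerivAt (fun x => x - xb) (ContinuousLinearMap.id ℝ X) x :=
      (hasFDerivAt_id x).sub_const xb
    have h2 := (fderiv ℝ g xb).hasFDerivAt.comp x h0
    have h3 := ((H.hasFDerivAt.comp x h0).clm_apply h0).const_smul (1 / 2 : ℝ)
    refine (((h1.sub_const (g xb)).sub h2).sub h3).congr_fderiv ?_
    ext v
    simp only [sub_apply, smul_apply, add_apply, ContinuousLinearMap.comp_apply,
      ContinuousLinearMap.flip_apply, ContinuousLinearMap.id_apply, Function.comp_apply]
    rw [hsymm v (x - xb), ← two_smul ℝ, smul_smul]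
    norm_num
  rw [Asymptotics.isLittleO_iff]
  intro c hc
  obtain ⟨r, hr, hb⟩ := Metric.eventually_nhds_iff.1
    ((hasFDerivAt_iff_isLittleO.1 hd).def hc)
  filter_upwards [Metric.ball_mem_nhds xb hr] with x hx
  have hmv := (convex_closedBall xb ‖x - xb‖).norm_image_sub_le_of_norm_hasFDerivWithin_le
    (C := c * ‖x - xb‖) (fun z _ => (hder z).hasFDerivWithinAt)
    (fun z hz => by
      have hz' : dist z xb ≤ ‖x - xb‖ := hz
      refine (hb (hz'.trans_lt (by rwa [← dist_eq_norm]))).trans ?_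
      rw [← dist_eq_norm z]
      gcongr)
    (Metric.mem_closedBall_self (norm_nonneg _)) (show x ∈ _ by simp [dist_eq_norm])
  simp only [sub_self, map_zero, smul_zero, sub_zero] at hmv
  rw [norm_pow, norm_norm, pow_two, ← mul_assoc]
  exact hmv

lemma tendsto_clm_apply {E F : Type*} [NormedAddCommGroup E] [NormedSpace ℝ E]
    [NormedAddCommGroup F] [NormedSpace ℝ F] {α : Type*} {l : Filter α} {M : α → E →L[ℝ] F}
    {M₀ : E →L[ℝ] F} {v : α → E} {v₀ : E} (hM : Tendsto M l (𝓝 M₀)) (hv : Tendsto v l (𝓝 v₀)) :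
    Tendsto (fun k => M k (v k)) l (𝓝 (M₀ v₀)) :=
  ((isBoundedBilinearMap_apply (𝕜 := ℝ)).continuous.tendsto (M₀, v₀)).comp (hM.prodMk_nhds hv)

lemma tendsto_taylor_two {X Y : Type*} [NormedAddCommGroup X] [NormedSpace ℝ X]
    [NormedAddCommGroup Y] [NormedSpace ℝ Y] {t : ℕ → ℝ} {uk : ℕ → X} {u : X} {g : X → Y}
    (hg : ContDiff ℝ 2 g) (xb : X) (ht : ∀ k, 0 < t k)
    (ht0 : Tendsto t atTop (𝓝 0)) (huk : Tendsto uk atTop (𝓝 u)) :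
    Tendsto (fun k => (t k ^ 2)⁻¹ • (g (xb + t k • uk k) - g xb - t k • fderiv ℝ g xb (uk k)))
      atTop (𝓝 ((1 / 2 : ℝ) • fderiv ℝ (fderiv ℝ g) xb u u)) := by
  have hx : Tendsto (fun k => xb + t k • uk k) atTop (𝓝 xb) := by
    simpa using (ht0.smul huk).const_add xb
  have h1 := (Asymptotics.isBigO_refl (fun k => (t k ^ 2)⁻¹) atTop).smul_isLittleO
    ((isLittleO_taylor_two hg xb).comp_tendsto hx)
  have h2 : (fun k => (t k ^ 2)⁻¹ • ‖xb + t k • uk k - xb‖ ^ 2) =O[atTop] fun _ => (1 : ℝ) := by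
    refine ((huk.norm.pow 2).isBigO_one ℝ).congr_left fun k => ?_
    rw [add_sub_cancel_left, norm_smul, mul_pow, Real.norm_of_nonneg (ht k).le, smul_eq_mul,
      inv_mul_cancel_left₀ (pow_ne_zero 2 (ht k).ne')]
  have h3 := (Asymptotics.isLittleO_one_iff ℝ).1 (h1.trans_isBigO h2)
  have h4 : Tendsto (fun k => (1 / 2 : ℝ) • fderiv ℝ (fderiv ℝ g) xb (uk k) (uk k)) atTop
      (𝓝 ((1 / 2 : ℝ) • fderiv ℝ (fderiv ℝ g) xb u u)) :=
    (tendsto_clm_apply (((fderiv ℝ (fderiv ℝ g) xb).continuous.tendsto u).comp huk)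
      huk).const_smul _
  have h5 := h3.add h4
  rw [zero_add] at h5
  refine h5.congr fun k => ?_
  have hk := (ht k).ne'
  simp only [Function.comp_apply, add_sub_cancel_left, map_smul, smul_apply]
  have hc : (t k ^ 2)⁻¹ * (1 / 2 * (t k * t k)) = 1 / 2 := by field_simp
  rw [smul_sub _ _ ((1 / 2 : ℝ) • _)]
  simp only [smul_smul, hc, sub_add_cancel]

section SecondOrder

variable {X Y : Type*} [NormedAddCommGroup X] [InnerProductSpace ℝ X] [FiniteDimensional ℝ X]
  [NormedAddCommGroup Y] [InnerProductSpace ℝ Y] [FiniteDimensional ℝ Y]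

lemma gradient_inner {g : X → Y} (hg : Differentiable ℝ g) (y : Y) :
    gradient (fun x => (inner ℝ y (g x) : ℝ)) = fun x => adjDeriv g x y := by
  funext x
  refine ext_inner_right ℝ fun v => ?_
  have h : HasFDerivAt (fun x => (inner ℝ y (g x) : ℝ)) ((innerSL ℝ y).comp (fderiv ℝ g x)) x :=
    (innerSL ℝ y).hasFDerivAt.comp x (hg x).hasFDerivAt
  rw [gradient, h.fderiv, InnerProductSpace.toDual_symm_apply, adjDeriv,
    ContinuousLinearMap.adjoint_inner_left]
  rfl

lemma hessScalar_eq {g : X → Y} (hg : ContDiff ℝ 2 g) (y : Y) (x u : X) :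
    hessScalar g y x u = ContinuousLinearMap.adjoint (fderiv ℝ (fderiv ℝ g) x u) y := by
  let L : (X →L[ℝ] Y) →ₗ[ℝ] X :=
    { toFun := fun M => ContinuousLinearMap.adjoint M y
      map_add' := fun M N => by simp
      map_smul' := fun c M => by simp }
  have hd : DifferentiableAt ℝ (fderiv ℝ g) x :=
    ((hg.fderiv_right (m := 1) (by norm_num)).differentiable (by norm_num)) x
  have h : HasFDerivAt (fun x => adjDeriv g x y)
      (L.toContinuousLinearMap.comp (fderiv ℝ (fderiv ℝ g) x)) x :=
    L.toContinuousLinearMap.hasFDerivAt.comp x hd.hasFDerivAt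
  rw [hessScalar, gradient_inner (hg.differentiable (by norm_num)), h.fderiv]
  rfl

lemma secondDeriv_eq {m : ℕ} (e : OrthonormalBasis (Fin m) ℝ Y) {g : X → Y}
    (hg : ContDiff ℝ 2 g) (x u : X) :
    secondDeriv e g x u = fderiv ℝ (fderiv ℝ g) x u u := by
  conv_rhs => rw [← e.sum_repr (fderiv ℝ (fderiv ℝ g) x u u)]
  refine Finset.sum_congr rfl fun i _ => ?_
  rw [hessScalar_eq hg, ContinuousLinearMap.adjoint_inner_right, e.repr_apply_apply,
    real_inner_comm]

end SecondOrder

section Expansions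

variable {X Y : Type*} [NormedAddCommGroup X] [InnerProductSpace ℝ X] [FiniteDimensional ℝ X]
  [NormedAddCommGroup Y] [InnerProductSpace ℝ Y] [FiniteDimensional ℝ Y]
  {t : ℕ → ℝ} {uk : ℕ → X} {u : X}

lemma tendsto_adjDeriv {g : X → Y} (hg : ContDiff ℝ 2 g) (xb : X) (ht : ∀ k, 0 < t k)
    (ht0 : Tendsto t atTop (𝓝 0)) (huk : Tendsto uk atTop (𝓝 u)) {ηk : ℕ → Y} {η : Y}
    (hη : Tendsto ηk atTop (𝓝 η)) :
    Tendsto (fun k => (t k)⁻¹ • (adjDeriv g (xb + t k • uk k) (ηk k) - adjDeriv g xb (ηk k)))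
      atTop (𝓝 (hessScalar g η xb u)) := by
  have hd : HasFDerivAt (fderiv ℝ g) (fderiv ℝ (fderiv ℝ g) xb) xb :=
    (((hg.fderiv_right (m := 1) (by norm_num)).differentiable (by norm_num)) xb).hasFDerivAt
  have hlim := (hasFDerivWithinAt_univ.2 hd).lim (c := fun k => (t k)⁻¹)
    (d := fun k => t k • uk k) (v := u) (by simpa using ht0.smul huk)
    (Eventually.of_forall fun _ => Set.mem_univ _) (by simpa [smul_smul, (ht _).ne'] using huk)
  have hadj := ((ContinuousLinearMap.adjoint (𝕜 := ℝ) (E := X) (F := Y)).continuous.tendsto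
    _).comp hlim
  rw [hessScalar_eq hg]
  refine (tendsto_clm_apply hadj hη).congr fun k => ?_
  simp [adjDeriv]

end Expansions

/-! ### Directional multipliers and limits of their difference quotients. -/

section Multipliers

variable {X Y : Type*} [NormedAddCommGroup X] [InnerProductSpace ℝ X] [FiniteDimensional ℝ X]
  [NormedAddCommGroup Y] [InnerProductSpace ℝ Y] [FiniteDimensional ℝ Y]

/-- If metric pseudo-subregularity of order 2 in direction `u` fails, then there is a nontrivial
directional multiplier, together with the second-order information on the sequences
generating it. -/
lemma exists_directional_multiplier {m : ℕ} (e : OrthonormalBasis (Fin m) ℝ Y) {g : X → Y}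
    (hg : ContDiff ℝ 2 g) {D : Set Y} (hD : IsClosed D) {xb u : X} (hxb : g xb ∈ D)
    (hu : ‖u‖ = 1) (hnot : ¬ IsMetricallyPseudoSubregular 2 (constraintMap g D) xb 0 u) :
    ∃ (t : ℕ → ℝ) (uk : ℕ → X) (wk ηk : ℕ → Y) (η : Y), (∀ k, 0 < t k) ∧
      Tendsto t atTop (𝓝 0) ∧ Tendsto wk atTop (𝓝 (fderiv ℝ g xb u)) ∧
      (∀ k, ηk k ∈ regularNormalCone D (g xb + t k • wk k)) ∧ ‖η‖ = 1 ∧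
      Tendsto ηk atTop (𝓝 η) ∧ adjDeriv g xb η = 0 ∧
      Tendsto (fun k => ContinuousLinearMap.adjoint (fderiv ℝ g xb) ((t k)⁻¹ • (ηk k - η))) atTop
        (𝓝 (-hessScalar g η xb u)) ∧
      Tendsto (fun k => (t k)⁻¹ • (wk k - fderiv ℝ g xb u) - fderiv ℝ g xb (uk k)) atTop
        (𝓝 ((1 / 2 : ℝ) • secondDeriv e g xb u)) := by
  obtain ⟨t, uk, yk, ηk, η, ht, ht0, huk, hN, hη1, hη, hgy, hadj⟩ :=
    exists_asymptotic_sequences (hg.differentiable (by norm_num)) hD hxb hu hnot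
  have hA : Tendsto (fun k => (t k)⁻¹ • adjDeriv g xb (ηk k)) atTop
      (𝓝 (-hessScalar g η xb u)) := by
    have h := hadj.sub (tendsto_adjDeriv hg xb ht ht0 huk hη)
    rw [zero_sub] at h
    exact h.congr fun k => by rw [← smul_sub, sub_sub_cancel]
  have hA0 : adjDeriv g xb η = 0 := by
    have h1 : Tendsto (fun k => adjDeriv g xb (ηk k)) atTop (𝓝 (adjDeriv g xb η)) :=
      ((ContinuousLinearMap.adjoint (fderiv ℝ g xb)).continuous.tendsto η).comp hη
    have h2 := ht0.smul hA
    rw [zero_smul] at h2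
    refine tendsto_nhds_unique h1 (h2.congr fun k => ?_)
    rw [smul_smul, mul_inv_cancel₀ (ht k).ne', one_smul]
  have hr : Tendsto (fun k => (t k ^ 2)⁻¹ • (yk k - g xb - t k • fderiv ℝ g xb (uk k))) atTop
      (𝓝 ((1 / 2 : ℝ) • secondDeriv e g xb u)) := by
    have h := (tendsto_taylor_two hg xb ht ht0 huk).sub hgy
    rw [sub_zero, ← secondDeriv_eq e hg] at h
    refine h.congr fun k => ?_
    rw [← smul_sub]
    congr 1
    abel
  have hw : ∀ k, (t k)⁻¹ • (yk k - g xb) = fderiv ℝ g xb (uk k) +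
      t k • ((t k ^ 2)⁻¹ • (yk k - g xb - t k • fderiv ℝ g xb (uk k))) := by
    intro k
    have hk := (ht k).ne'
    have hc : t k * (t k ^ 2)⁻¹ = (t k)⁻¹ := by field_simp
    rw [smul_smul, hc, smul_sub _ _ (t k • _), smul_smul, inv_mul_cancel₀ hk, one_smul,
      add_sub_cancel]
  -- The returned sequence in `X` is the quotient `(uk k - u) / t k`, which may be unbounded.
  refine ⟨t, fun k => (t k)⁻¹ • (uk k - u), fun k => (t k)⁻¹ • (yk k - g xb), ηk, η, ht, ht0, ?_,
    fun k => ?_, hη1, hη, hA0, ?_, ?_⟩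
  · simp only [hw]
    simpa using (((fderiv ℝ g xb).continuous.tendsto u).comp huk).add (ht0.smul hr)
  · rw [smul_smul, mul_inv_cancel₀ (ht k).ne', one_smul, add_sub_cancel]
    exact hN k
  · refine hA.congr fun k => ?_
    rw [map_smul, map_sub]
    change _ = (t k)⁻¹ • (adjDeriv g xb (ηk k) - adjDeriv g xb η)
    rw [hA0, sub_zero]
  · refine hr.congr fun k => ?_
    beta_reduce
    rw [hw, map_smul, map_sub, add_sub_right_comm, smul_add, smul_smul,
      inv_mul_cancel₀ (ht k).ne', one_smul, add_sub_cancel_left]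

variable {E F : Type*} [NormedAddCommGroup E] [InnerProductSpace ℝ E]

lemma regularNormalCone_subset_limitingNormalCone (Q : Set E) (x : E) :
    regularNormalCone Q x ⊆ limitingNormalCone Q x := fun η hη =>
  ⟨hη.1, fun _ => x, fun _ => η, fun _ => hη.1, tendsto_const_nhds, tendsto_const_nhds, fun _ => hη⟩

lemma mem_limitingNormalCone_of_tendsto {Q : Set E} {x η : E} (hx : x ∈ Q) {xk ηk : ℕ → E}
    (hxk : Tendsto xk atTop (𝓝 x)) (hηk : Tendsto ηk atTop (𝓝 η))
    (h : ∀ k, ηk k ∈ regularNormalCone Q (xk k)) : η ∈ limitingNormalCone Q x :=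
  ⟨hx, xk, ηk, fun k => (h k).1, hxk, hηk, h⟩

lemma tangentCone_mono {Q Q' : Set E} (h : Q ⊆ Q') (x : E) :
    tangentCone Q x ⊆ tangentCone Q' x := by
  rintro d ⟨hx, dk, t, hdk, ht, ht0, hQ⟩
  exact ⟨h hx, dk, t, hdk, ht, ht0, fun k => h (hQ k)⟩

variable [NormedAddCommGroup F] [NormedSpace ℝ F]

/-- Difference quotients in the graph of a set-valued mapping either generate an element of the
graphical derivative, or they are unbounded. -/
lemma graphicalDeriv_alternative [FiniteDimensional ℝ E] {N : E → Set E} {y w η : E}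
    (hyη : (y, η) ∈ gph N) (A : E →L[ℝ] F) {b : F} {t : ℕ → ℝ} {wk ηk : ℕ → E}
    (ht : ∀ k, 0 < t k) (ht0 : Tendsto t atTop (𝓝 0)) (hwk : Tendsto wk atTop (𝓝 w))
    (hηk : Tendsto ηk atTop (𝓝 η)) (hN : ∀ k, ηk k ∈ N (y + t k • wk k))
    (hb : Tendsto (fun k => A ((t k)⁻¹ • (ηk k - η))) atTop (𝓝 b)) :
    (∃ z ∈ graphicalDeriv N y η w, A z = b) ∨
      ∃ z : E, ‖z‖ = 1 ∧ A z = 0 ∧ z ∈ graphicalDeriv N y η 0 ∧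
        (w ≠ 0 → z ∈ graphicalSubderiv N y η (‖w‖⁻¹ • w)) := by
  set zk : ℕ → E := fun k => (t k)⁻¹ • (ηk k - η) with hzk
  by_cases hbd : Tendsto (fun k => ‖zk k‖) atTop atTop
  · right
    obtain ⟨n₀, hn₀⟩ := eventually_atTop.1 (hbd.eventually_gt_atTop 0)
    obtain ⟨z, hz, φ₀, hφ₀, hlim⟩ := (isCompact_sphere (0 : E) 1).tendsto_subseq
      (x := fun k => ‖zk (k + n₀)‖⁻¹ • zk (k + n₀)) (fun k => by
        have := (hn₀ (k + n₀) (by omega)).ne'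
        simp [norm_smul, this])
    obtain ⟨φ, hφ, hφn, hlim⟩ : ∃ φ : ℕ → ℕ, Tendsto φ atTop atTop ∧ (∀ k, 0 < ‖zk (φ k)‖) ∧
        Tendsto (fun k => ‖zk (φ k)‖⁻¹ • zk (φ k)) atTop (𝓝 z) :=
      ⟨fun k => φ₀ k + n₀, (tendsto_add_atTop_nat n₀).comp hφ₀.tendsto_atTop,
        fun k => hn₀ _ (Nat.le_add_left _ _), hlim⟩
    have hz1 : ‖z‖ = 1 := by simpa using hz
    have hinv : Tendsto (fun k => ‖zk (φ k)‖⁻¹) atTop (𝓝 0) := (hbd.comp hφ).inv_tendsto_atTop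
    have htφ := ht0.comp hφ
    -- The step `τ = t ‖zk‖ = ‖ηk - η‖` tends to zero with `τ / t → ∞`. Measured in `τ`, the base
    -- displacement vanishes, giving the graphical derivative at `0`; measured in `t`, it gives the
    -- subderivative.
    have hτpos : ∀ k, 0 < t (φ k) * ‖zk (φ k)‖ := fun k => mul_pos (ht _) (hφn k)
    have hτ : Tendsto (fun k => t (φ k) * ‖zk (φ k)‖) atTop (𝓝 0) := by
      have h1 : Tendsto (fun k => ‖ηk (φ k) - η‖) atTop (𝓝 0) :=
        tendsto_iff_norm_sub_tendsto_zero.1 (hηk.comp hφ)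
      refine h1.congr fun k => ?_
      rw [hzk, norm_smul, norm_inv, Real.norm_of_nonneg (ht _).le,
        mul_inv_cancel_left₀ (ht _).ne']
    have hmem : ∀ k, η + (t (φ k) * ‖zk (φ k)‖) • (‖zk (φ k)‖⁻¹ • zk (φ k)) ∈
        N (y + t (φ k) • wk (φ k)) := by
      intro k
      rw [smul_smul, mul_assoc, mul_inv_cancel₀ (hφn k).ne', mul_one, hzk, smul_smul,
        mul_inv_cancel₀ (ht _).ne', one_smul, add_sub_cancel]
      exact hN _
    refine ⟨z, hz1, ?_, ⟨hyη, fun k => (‖zk (φ k)‖⁻¹ • wk (φ k), ‖zk (φ k)‖⁻¹ • zk (φ k)),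
      fun k => t (φ k) * ‖zk (φ k)‖, ?_, hτpos, hτ, fun k => ?_⟩, fun hw => ?_⟩
    · have h1 := (A.continuous.tendsto z).comp hlim
      have h2 := hinv.smul (hb.comp hφ)
      rw [zero_smul] at h2
      refine tendsto_nhds_unique h1 (h2.congr fun k => ?_)
      rw [Function.comp_apply, Function.comp_apply, map_smul A (‖zk (φ k)‖⁻¹)]
    · refine Tendsto.prodMk_nhds ?_ hlim
      simpa using hinv.smul (hwk.comp hφ)
    · change _ ∈ N (y + _ • _)
      rw [smul_smul (t (φ k) * ‖zk (φ k)‖), mul_assoc, mul_inv_cancel₀ (hφn k).ne', mul_one]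
      exact hmem k
    · have hw0 : 0 < ‖w‖ := norm_pos_iff.2 hw
      refine ⟨hyη, by rw [norm_smul, norm_inv, norm_norm, inv_mul_cancel₀ hw0.ne'], hz1,
        fun k => ‖w‖⁻¹ • wk (φ k), fun k => ‖zk (φ k)‖⁻¹ • zk (φ k), fun k => t (φ k) * ‖w‖,
        fun k => t (φ k) * ‖zk (φ k)‖, (hwk.comp hφ).const_smul _, hlim,
        fun k => mul_pos (ht _) hw0, ?_, hτpos, hτ, ?_, fun k => ?_⟩
      · simpa using htφ.mul_const ‖w‖
      · refine ((hbd.comp hφ).atTop_div_const hw0).congr fun k => ?_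
        rw [mul_div_mul_left _ _ (ht _).ne']
        rfl
      · change _ ∈ N (y + _ • _)
        rw [smul_smul (t (φ k) * ‖w‖), mul_assoc, mul_inv_cancel₀ hw0.ne', mul_one]
        exact hmem k
  · left
    rw [tendsto_atTop] at hbd
    push Not at hbd
    obtain ⟨M, hM⟩ := hbd
    obtain ⟨z, -, φ, hφ, hz⟩ := tendsto_subseq_of_frequently_bounded
      (x := zk) (s := Metric.closedBall (0 : E) M) Metric.isBounded_closedBall (by
        refine hM.mono fun k hk => ?_
        rw [mem_closedBall_zero_iff]
        exact hk.le)
    refine ⟨z, ⟨hyη, fun k => (wk (φ k), zk (φ k)), fun k => t (φ k),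
      (hwk.comp hφ.tendsto_atTop).prodMk_nhds hz, fun k => ht _, ht0.comp hφ.tendsto_atTop,
      fun k => ?_⟩, ?_⟩
    · change η + t (φ k) • zk (φ k) ∈ N (y + t (φ k) • wk (φ k))
      rw [hzk, smul_smul, mul_inv_cancel₀ (ht _).ne', one_smul, add_sub_cancel]
      exact hN _
    · exact tendsto_nhds_unique ((A.continuous.tendsto z).comp hz) (hb.comp hφ.tendsto_atTop)

/-- Along a sequence of regular normals to a sign-determined set, difference quotients can be
replaced by a tangent to one of finitely many regular normal cones. -/
lemma IsSignDetermined.exists_tangent_normal {ι : Type*} [Finite ι] [FiniteDimensional ℝ E]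
    {a : ι → E} {T : Set E} (hT : IsSignDetermined a T) (hTc : IsClosed T) (A : E →L[ℝ] F)
    {b : F} {t : ℕ → ℝ} {qk ηk : ℕ → E} {η : E} (ht : ∀ k, 0 < t k)
    (hηk : Tendsto ηk atTop (𝓝 η)) (hN : ∀ᶠ k in atTop, ηk k ∈ regularNormalCone T (qk k))
    (hb : Tendsto (fun k => A ((t k)⁻¹ • (ηk k - η))) atTop (𝓝 b)) :
    ∃ φ : ℕ → ℕ, Tendsto φ atTop atTop ∧ (∀ k, SameSigns a (qk (φ 0)) (qk (φ k))) ∧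
      qk (φ 0) ∈ T ∧ ∃ z ∈ tangentCone (regularNormalCone T (qk (φ 0))) η, A z = b := by
  obtain ⟨n₀, hn₀⟩ := eventually_atTop.1 hN
  obtain ⟨φ₀, hφ₀, hsame⟩ := exists_sameSigns_subseq a fun k => qk (k + n₀)
  obtain ⟨φ, hφ, hsame, hN⟩ : ∃ φ : ℕ → ℕ, Tendsto φ atTop atTop ∧
      (∀ k, SameSigns a (qk (φ 0)) (qk (φ k))) ∧
      ∀ k, ηk (φ k) ∈ regularNormalCone T (qk (φ k)) :=
    ⟨fun k => φ₀ k + n₀, (tendsto_add_atTop_nat n₀).comp hφ₀.tendsto_atTop, hsame,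
      fun k => hn₀ _ (Nat.le_add_left _ _)⟩
  have hq := (hN 0).1
  obtain ⟨R, hR, hNR⟩ := hT.exists_finite_regularNormalCone_eq hTc hq
  have hmem : ∀ k, ηk (φ k) ∈ polarCone R := fun k => by
    rw [← hNR, hT.regularNormalCone_eq hTc (hsame k)]
    exact hN k
  have hη : η ∈ polarCone R :=
    (isClosed_polarCone R).mem_of_tendsto (hηk.comp hφ) (Eventually.of_forall hmem)
  refine ⟨φ, hφ, hsame, hq, ?_⟩
  rw [hNR]
  exact exists_mem_tangentCone_polarCone_of_tendsto hR A hη hmem (t := t ∘ φ) (fun k => ht _)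
    (hb.comp hφ)

lemma smul_mem_tangentCone_iff {Q : Set E} {x d : E} {s : ℝ} (hs : 0 < s) :
    s • d ∈ tangentCone Q x ↔ d ∈ tangentCone Q x := by
  refine ⟨fun h => ?_, fun h => smul_mem_tangentCone h hs⟩
  simpa [smul_smul, hs.ne'] using smul_mem_tangentCone h (inv_pos.2 hs)

lemma regularNormalCone_add_smul {Q : Set E} {x : E} {ε : ℝ}
    (h : ∀ d, ‖d‖ < ε → (x + d ∈ Q ↔ d ∈ tangentCone Q x)) {t : ℝ} (ht : 0 < t) {q : E}
    (hq : ‖t • q‖ < ε) : regularNormalCone Q (x + t • q) = regularNormalCone (tangentCone Q x) q := by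
  refine regularNormalCone_affine ht ?_
  have hc : Continuous fun z : E => ‖t • z‖ := by fun_prop
  filter_upwards [(hc.tendsto q).eventually_lt_const hq] with z hz
  rw [h _ hz, smul_mem_tangentCone_iff ht]

end Multipliers

/-! ### The polyhedral case. -/

section Polyhedral

variable {X Y : Type*} [NormedAddCommGroup X] [InnerProductSpace ℝ X] [FiniteDimensional ℝ X]
  [NormedAddCommGroup Y] [InnerProductSpace ℝ Y] [FiniteDimensional ℝ Y]

/-- The `s k` may diverge, so project along the range of `G`, use that the image of the closed cell
is closed, and recover `s'` from the difference in the range. -/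
lemma exists_mem_range_cell {ι : Type*} [Finite ι] (a : ι → Y) (G : X →L[ℝ] Y) {p : Y}
    {q₀ : Y} {q : ℕ → Y} {s : ℕ → X} (hq : ∀ k, SameSigns a q₀ (q k))
    (hlim : Tendsto (fun k => q k - G (s k)) atTop (𝓝 p)) :
    ∃ s' : X, G s' + p ∈ polarCone (cellInequalities a q₀) := by
  let W : Submodule ℝ Y := LinearMap.range (G : X →ₗ[ℝ] Y)
  obtain ⟨q', hq', hπ⟩ := exists_mem_polarCone_of_tendsto (finite_cellInequalities a q₀)
    Wᗮ.starProjection (z := q) (b := Wᗮ.starProjection p) (fun k => (hq k).mem_polarCone) (by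
      refine ((Wᗮ.starProjection.continuous.tendsto p).comp hlim).congr fun k => ?_
      have h0 : Wᗮ.starProjection (G (s k)) = 0 := by
        rw [Submodule.starProjection_apply_eq_zero_iff, Submodule.orthogonal_orthogonal]
        exact ⟨s k, rfl⟩
      rw [Function.comp_apply, map_sub, h0, sub_zero])
  have hmem : q' - p ∈ W := by
    rw [← Submodule.orthogonal_orthogonal W, ← Submodule.starProjection_apply_eq_zero_iff, map_sub,
      hπ, sub_self]
  obtain ⟨s', hs'⟩ := hmem
  refine ⟨s', ?_⟩
  have : G s' = q' - p := hs'
  rwa [this, sub_add_cancel]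

lemma exists_multiplier_tangent_of_polyhedral {n : ℕ} {a : Fin n → Y} {D : Set Y}
    (hD : IsClosed D) {y w : Y} (hloc : IsLocallySignDetermined a D y) (hy : y ∈ D)
    (A : Y →L[ℝ] X) (G : X →L[ℝ] Y) {b : X} {p : Y} {t : ℕ → ℝ} {s : ℕ → X} {wk ηk : ℕ → Y} {η : Y}
    (ht : ∀ k, 0 < t k) (ht0 : Tendsto t atTop (𝓝 0)) (hwk : Tendsto wk atTop (𝓝 w))
    (hN : ∀ k, ηk k ∈ regularNormalCone D (y + t k • wk k)) (hηk : Tendsto ηk atTop (𝓝 η))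
    (hb : Tendsto (fun k => A ((t k)⁻¹ • (ηk k - η))) atTop (𝓝 b))
    (hp : Tendsto (fun k => (t k)⁻¹ • (wk k - w) - G (s k)) atTop (𝓝 p)) :
    (∃ z ∈ tangentCone (limitingNormalCone (tangentCone D y) w) η, A z = b) ∧
      ∃ s' : X, ∃ z ∈ tangentCone
        (limitingNormalCone (tangentCone (tangentCone D y) w) (G s' + p)) η, A z = b := by
  set T := tangentCone D y with hT_def
  have hT : IsSignDetermined a T := hloc.isSignDetermined_tangentCone hD
  have hTc : IsClosed T := hloc.isClosed_tangentCone hD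
  obtain ⟨ε, hε, hmem⟩ := hloc.exists_mem_iff hD hy
  have htw : Tendsto (fun k => ‖t k • wk k‖) atTop (𝓝 0) := by
    simpa using (ht0.smul hwk).norm
  have hNT : ∀ᶠ k in atTop, ηk k ∈ regularNormalCone T (wk k) := by
    filter_upwards [htw.eventually_lt_const hε] with k hk
    rw [← regularNormalCone_add_smul hmem (ht k) hk]
    exact hN k
  have hw : w ∈ T := hTc.mem_of_tendsto hwk (hNT.mono fun k hk => hk.1)
  constructor
  · obtain ⟨φ, hφ, hsame, -, z, hz, hzb⟩ := hT.exists_tangent_normal hTc A ht hηk hNT hb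
    refine ⟨z, tangentCone_mono (fun ξ hξ => ?_) η hz, hzb⟩
    refine mem_limitingNormalCone_of_tendsto hw (hwk.comp hφ) tendsto_const_nhds fun k => ?_
    rw [Function.comp_apply, ← hT.regularNormalCone_eq hTc (hsame k)]
    exact hξ
  · set TT := tangentCone T w with hTT_def
    have hTT : IsSignDetermined a TT := (hT.locally w).isSignDetermined_tangentCone hTc
    have hTTc : IsClosed TT := (hT.locally w).isClosed_tangentCone hTc
    obtain ⟨ε', hε', hmem'⟩ := (hT.locally w).exists_mem_iff hTc hw
    -- Second zoom: `T` coincides with `w + TT` near `w`, so the normals can be read at the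
    -- second-order quotients.
    have hNTT : ∀ᶠ k in atTop, ηk k ∈ regularNormalCone TT ((t k)⁻¹ • (wk k - w)) := by
      filter_upwards [(tendsto_iff_norm_sub_tendsto_zero.1 hwk).eventually_lt_const hε', hNT]
        with k hk hk'
      have h1 : t k • ((t k)⁻¹ • (wk k - w)) = wk k - w := by
        rw [smul_smul, mul_inv_cancel₀ (ht k).ne', one_smul]
      rw [← regularNormalCone_add_smul hmem' (ht k) (by rwa [h1]), h1, add_sub_cancel]
      exact hk'
    obtain ⟨φ, hφ, hsame, hq₀, z, hz, hzb⟩ := hTT.exists_tangent_normal hTTc A ht hηk hNTT hb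
    obtain ⟨s', hs'⟩ := exists_mem_range_cell a G hsame (hp.comp hφ)
    set q₀ := (t (φ 0))⁻¹ • (wk (φ 0) - w) with hq₀_def
    have hcell : ∀ k : ℕ, SameSigns a q₀ (G s' + p + (1 / ((k : ℝ) + 1)) • q₀) :=
      -- `G s' + p` is only in the closed cell of `q₀`; a small push along `q₀` enters the cell
      -- itself, where the regular normal cone is that at `q₀`.
      fun k => sameSigns_add_smul hs' (by positivity)
    have hlim := tendsto_add_inv_smul (G s' + p) q₀
    have hq : G s' + p ∈ TT :=
      hTTc.mem_of_tendsto hlim (Eventually.of_forall fun k => hTT _ _ (hcell k) hq₀)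
    refine ⟨s', z, tangentCone_mono (fun ξ hξ => ?_) η hz, hzb⟩
    refine mem_limitingNormalCone_of_tendsto hq hlim tendsto_const_nhds fun k => ?_
    rw [← hTT.regularNormalCone_eq hTTc (hcell k)]
    exact hξ

end Polyhedral

end PseudoSubreg

theorem corollary3p4
    {X : Type*} [NormedAddCommGroup X] [InnerProductSpace ℝ X] [FiniteDimensional ℝ X]
    {Y : Type*} [NormedAddCommGroup Y] [InnerProductSpace ℝ Y] [FiniteDimensional ℝ Y]
    {m : ℕ} (e : OrthonormalBasis (Fin m) ℝ Y)
    (g : X → Y) (hg : ContDiff ℝ 2 g) (D : Set Y) (hD : IsClosed D)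
    (xb : X) (hxb : (xb, (0 : Y)) ∈ PseudoSubreg.gph (PseudoSubreg.constraintMap g D))
    (u : X) (hu : ‖u‖ = 1)
    (hcond :
      -- condition (i)
      (∀ y z : Y,
        PseudoSubreg.adjDeriv g xb y = 0 →
        PseudoSubreg.hessScalar g y xb u + PseudoSubreg.adjDeriv g xb z = 0 →
        y ∈ PseudoSubreg.dirNormalCone D (g xb) (fderiv ℝ g xb u) →
        inner ℝ z y = 0 →
        y = 0) ∨
      -- condition (ii)
      ((∀ y z : Y,
          PseudoSubreg.adjDeriv g xb y = 0 →
          PseudoSubreg.hessScalar g y xb u + PseudoSubreg.adjDeriv g xb z = 0 →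
          y ∈ PseudoSubreg.dirNormalCone D (g xb) (fderiv ℝ g xb u) →
          z ∈ PseudoSubreg.graphicalDeriv (PseudoSubreg.limitingNormalCone D) (g xb) y
            (fderiv ℝ g xb u) →
          y = 0) ∧
        ((∀ y z : Y,
            PseudoSubreg.adjDeriv g xb y = 0 →
            PseudoSubreg.adjDeriv g xb z = 0 →
            y ∈ PseudoSubreg.dirNormalCone D (g xb) (fderiv ℝ g xb u) →
            z ∈ PseudoSubreg.graphicalDeriv (PseudoSubreg.limitingNormalCone D) (g xb) y 0 →
            z = 0) ∨
          (fderiv ℝ g xb u ≠ 0 ∧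
            ∀ y z : Y,
              PseudoSubreg.adjDeriv g xb y = 0 →
              PseudoSubreg.adjDeriv g xb z = 0 →
              y ∈ PseudoSubreg.dirNormalCone D (g xb) (fderiv ℝ g xb u) →
              z ∉ PseudoSubreg.graphicalSubderiv (PseudoSubreg.limitingNormalCone D) (g xb) y
                (‖fderiv ℝ g xb u‖⁻¹ • fderiv ℝ g xb u)))) ∨
      -- condition (iii)
      (PseudoSubreg.IsLocallyPolyhedral e D (g xb) ∧
        ∀ y z : Y,
          PseudoSubreg.adjDeriv g xb y = 0 →
          PseudoSubreg.hessScalar g y xb u + PseudoSubreg.adjDeriv g xb z = 0 →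
          y ∈ PseudoSubreg.limitingNormalCone (PseudoSubreg.tangentCone D (g xb))
            (fderiv ℝ g xb u) →
          z ∈ PseudoSubreg.tangentCone
            (PseudoSubreg.limitingNormalCone (PseudoSubreg.tangentCone D (g xb))
              (fderiv ℝ g xb u)) y →
          y = 0) ∨
      -- condition (iv)
      (PseudoSubreg.IsLocallyPolyhedral e D (g xb) ∧
        ∀ (s : X) (y z : Y),
          PseudoSubreg.adjDeriv g xb y = 0 →
          PseudoSubreg.hessScalar g y xb u + PseudoSubreg.adjDeriv g xb z = 0 →
          y ∈ PseudoSubreg.limitingNormalCone (PseudoSubreg.bigT g D xb u)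
            (PseudoSubreg.wVec e g xb s u 0) →
          z ∈ PseudoSubreg.tangentCone
            (PseudoSubreg.limitingNormalCone (PseudoSubreg.bigT g D xb u)
              (PseudoSubreg.wVec e g xb s u 0)) y →
          y = 0)) :
    PseudoSubreg.IsMetricallyPseudoSubregular 2 (PseudoSubreg.constraintMap g D) xb 0 u := by
  by_contra hnot
  have hxD : g xb ∈ D := by
    obtain ⟨d, hd, h⟩ := hxb
    rwa [sub_eq_zero.1 h.symm]
  obtain ⟨t, uk, wk, ηk, η, ht, ht0, hwk, hN, hη1, hηk, hA0, hb, hp⟩ :=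
    PseudoSubreg.exists_directional_multiplier e hg hD hxD hu hnot
  have hη0 : η ≠ 0 := by
    rintro rfl
    simp at hη1
  have hdir : η ∈ PseudoSubreg.dirNormalCone D (g xb) (fderiv ℝ g xb u) :=
    ⟨hxD, wk, t, ηk, hwk, ht, ht0, hηk, hN⟩
  have hhess : ∀ z : Y, ContinuousLinearMap.adjoint (fderiv ℝ g xb) z =
      -PseudoSubreg.hessScalar g η xb u →
      PseudoSubreg.hessScalar g η xb u + PseudoSubreg.adjDeriv g xb z = 0 := by
    intro z hz
    rw [PseudoSubreg.adjDeriv, hz, add_neg_cancel]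
  have htw : Tendsto (fun k => g xb + t k • wk k) atTop (𝓝 (g xb)) := by
    simpa using (ht0.smul hwk).const_add (g xb)
  rcases hcond with h | ⟨h, h'⟩ | ⟨hpoly, h⟩ | ⟨hpoly, h⟩
  -- With no inequalities the cone is all of `Y`, so this is closedness of the range of the adjoint.
  · obtain ⟨z, -, hz⟩ := PseudoSubreg.exists_mem_polarCone_of_tendsto Set.finite_empty
      (ContinuousLinearMap.adjoint (fderiv ℝ g xb)) (z := fun k => (t k)⁻¹ • (ηk k - η))
      (fun k a ha => ha.elim) hb
    refine hη0 (h η (z - (inner ℝ z η : ℝ) • η) hA0 (hhess _ ?_) hdir ?_)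
    · have h0 : ContinuousLinearMap.adjoint (fderiv ℝ g xb) η = 0 := hA0
      rw [map_sub, map_smul, h0, smul_zero, sub_zero, hz]
    · rw [inner_sub_left, real_inner_smul_left, real_inner_self_eq_norm_sq, hη1]
      ring
  · have hgph : (g xb, η) ∈ PseudoSubreg.gph (PseudoSubreg.limitingNormalCone D) :=
      PseudoSubreg.mem_limitingNormalCone_of_tendsto hxD htw hηk hN
    rcases PseudoSubreg.graphicalDeriv_alternative hgph
      (ContinuousLinearMap.adjoint (fderiv ℝ g xb)) ht ht0 hwk hηk
      (fun k => PseudoSubreg.regularNormalCone_subset_limitingNormalCone _ _ (hN k)) hb with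
      ⟨z, hz, hzb⟩ | ⟨z, hz1, hAz, hz, hzsub⟩
    · exact hη0 (h η z hA0 (hhess z hzb) hdir hz)
    · rcases h' with h' | ⟨hw, h'⟩
      · rw [h' η z hA0 hAz hdir hz, norm_zero] at hz1
        exact zero_ne_one hz1
      · exact h' η z hA0 hAz hdir (hzsub hw)
  · obtain ⟨n, a, hloc⟩ := hpoly.exists_isLocallySignDetermined
    obtain ⟨⟨z, hz, hzb⟩, -⟩ := PseudoSubreg.exists_multiplier_tangent_of_polyhedral hD hloc hxD
      _ _ ht ht0 hwk hN hηk hb hp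
    exact hη0 (h η z hA0 (hhess z hzb) hz.1 hz)
  · obtain ⟨n, a, hloc⟩ := hpoly.exists_isLocallySignDetermined
    obtain ⟨-, s, z, hz, hzb⟩ := PseudoSubreg.exists_multiplier_tangent_of_polyhedral hD hloc hxD
      _ _ ht ht0 hwk hN hηk hb hp
    rw [← sub_zero (fderiv ℝ g xb s + _)] at hz
    exact hη0 (h s η z hA0 (hhess z hzb) hz.1 hz)
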